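/- Let $r\ge 5$ be an integer and let $F(x,y)\in\mathbb{Z}[x,y]$ be a diagonalizable binary form of degree $r$, that is, $F(x,y)=(\alpha x+\beta y)^r-(\gamma x+\delta y)^r$ for some constants $\alpha,\beta,\gamma,\delta\in\mathbb{C}$ with $\alpha\delta-\beta\gamma\neq 0$. Then $(\alpha x+\beta y)(\gamma x+\delta y)=\chi\,(Ax^2+Bxy+Cy^2)$ for some $A,B,C\in\mathbb{Z}$ and a constant $\chi$; put $D=B^2-4AC$ (a nonzero integer whose sign depends only on $F$), and let $\Delta$ be the discriminant of the binary form $F$. For a positive integer $h$ let $N_F(h)$ be the number of pairs $(x,y)\in\mathbb{Z}^2$ with $\gcd(x,y)=1$ and $0<|F(x,y)|\le h$, where $(x,y)$ and $(-x,-y)$ are counted as one. Call $F$ definite if it takes only positive values, or only negative values, on $\mathbb{R}^2\setminus\{(0,0)\}$, and indefinite if it takes both positive and negative values on $\mathbb{R}^2$. Let $\epsilon$ be a real number with $0<\epsilon<\frac{1}{2(r-1)}$, and let $h$ be a positive integer with $$h\le\frac{|\Delta|^{\frac{1}{2(r-1)}-\epsilon}}{2^{r/2}\,r^{7}}.$$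 (i) If $m\ge 3$ is an integer with $$\frac{r^2+r+2}{4(r-1)\left[(r-1)^{m-1}-2r-1\right]}<\epsilon,$$ then $$N_F(h)\le\begin{cases} rm & \text{if } D<0,\\ 2m & \text{if } D>0,\ r \text{ is even and } F \text{ is indefinite},\\ m & \text{if } D>0,\ r\text{ is odd and } F \text{ is indefinite},\\ 1 & \text{if } D>0 \text{ and } F \text{ is definite}.\end{cases}$$ (ii) If $D<0$, then $$N_F(h)\le\left(4+\left\lceil\frac{\log(1/\epsilon)-\log 4}{\log(r-1)}\right\rceil\right) r .$$ -/

import Mathlib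

open MvPolynomial

/-- `F = (α x + β y)^r - (γ x + δ y)^r` with complex constants satisfying `j = α δ - β γ ≠ 0`. -/
def IsDiagonalization (r : ℕ) (F : MvPolynomial (Fin 2) ℤ) (α β γ δ : ℂ) : Prop :=
  α * δ - β * γ ≠ 0 ∧
    MvPolynomial.map (Int.castRingHom ℂ) F =
      (C α * X 0 + C β * X 1) ^ r - (C γ * X 0 + C δ * X 1) ^ r

/-- A binary form with integer coefficients is diagonalizable of degree `r` if it is
`(α x + β y)^r - (γ x + δ y)^r` for some constants with `α δ - β γ ≠ 0`. -/
def IsDiagonalizable (r : ℕ) (F : MvPolynomial (Fin 2) ℤ) : Prop :=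
  ∃ α β γ δ : ℂ, IsDiagonalization r F α β γ δ

/-- `D = B² - 4AC` for some integers `A, B, C` and a constant `χ` with
`(α x + β y) (γ x + δ y) = χ (A x² + B x y + C y²)`. Since `A, B, C` may be multiplied by a common
integer, `D` is determined only up to a rational square factor; only its sign is used. -/
def IsQuadraticDiscriminant (r : ℕ) (F : MvPolynomial (Fin 2) ℤ) (D : ℤ) : Prop :=
  ∃ (α β γ δ χ : ℂ) (a b c : ℤ), IsDiagonalization r F α β γ δ ∧
    (C α * X 0 + C β * X 1) * (C γ * X 0 + C δ * X 1) =
      (C χ * (C (a : ℂ) * X 0 ^ 2 + C (b : ℂ) * X 0 * X 1 + C (c : ℂ) * X 1 ^ 2) :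
        MvPolynomial (Fin 2) ℂ) ∧
    D = b ^ 2 - 4 * a * c

/-- The discriminant of a binary form of degree `r`,
`Δ(F) = (-1)^(r(r-1)/2) r^(-(r-2)) Res(F_x, F_y)`, where the partial derivatives are taken as
binary forms of degree `r - 1`, so that a vanishing coefficient of `x^r` is allowed.
It equals `∏_{i<j} (a_i b_j - a_j b_i)²` for `F = ∏ (a_i x + b_i y)` over `ℂ`. -/
noncomputable def formDiscr (r : ℕ) (F : MvPolynomial (Fin 2) ℤ) : ℚ :=
  (-1) ^ (r * (r - 1) / 2) *
    ((Polynomial.resultant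
      (aeval ![(Polynomial.X : Polynomial ℤ), 1] (pderiv 0 F))
      (aeval ![(Polynomial.X : Polynomial ℤ), 1] (pderiv 1 F)) (r - 1) (r - 1) : ℤ) : ℚ) /
    (r : ℚ) ^ (r - 2)

/-- The primitive integer solutions of `0 < |F(x, y)| ≤ h`. -/
def primitiveSolutions (F : MvPolynomial (Fin 2) ℤ) (h : ℤ) : Set (ℤ × ℤ) :=
  {p | Int.gcd p.1 p.2 = 1 ∧ 0 < |eval ![p.1, p.2] F| ∧ |eval ![p.1, p.2] F| ≤ h}

/-- `N_F(h)`: the number of primitive solutions of `0 < |F(x, y)| ≤ h`, where `(x, y)` and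
`(-x, -y)` count as one solution. The value is `⊤` if there are infinitely many. -/
noncomputable def numPrimitiveSolutions (F : MvPolynomial (Fin 2) ℤ) (h : ℤ) : ℕ∞ :=
  ((fun p : ℤ × ℤ => ({p, -p} : Set (ℤ × ℤ))) '' primitiveSolutions F h).encard

/-- A binary form is definite if its values at all nonzero real vectors are positive, or its
values at all nonzero real vectors are negative. -/
def IsDefiniteForm (F : MvPolynomial (Fin 2) ℤ) : Prop :=
  (∀ v : Fin 2 → ℝ, v ≠ 0 → 0 < aeval v F) ∨ (∀ v : Fin 2 → ℝ, v ≠ 0 → aeval v F < 0)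

/-- A binary form is indefinite if it takes positive and negative real values. -/
def IsIndefiniteForm (F : MvPolynomial (Fin 2) ℤ) : Prop :=
  (∃ v : Fin 2 → ℝ, 0 < aeval v F) ∧ (∃ v : Fin 2 → ℝ, aeval v F < 0)

theorem IsDiagonalization.exists_coeff {r : ℕ} {F : MvPolynomial (Fin 2) ℤ} {α β γ δ : ℂ}
    (hF : IsDiagonalization r F α β γ δ) (k : ℕ) :
    ∃ z : ℤ, (z : ℂ) = r.choose k * (α ^ (r - k) * β ^ k - γ ^ (r - k) * δ ^ k) := by
  have key : ∀ a b : ℂ, ((Polynomial.C a + Polynomial.C b * Polynomial.X) ^ r).coeff k =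
      r.choose k * (a ^ (r - k) * b ^ k) := by
    intro a b
    have h1 : (Polynomial.C a + Polynomial.C b * Polynomial.X) ^ r =
        ((Polynomial.X + Polynomial.C a) ^ r).comp (Polynomial.C b * Polynomial.X) := by
      simp [add_comm]
    rw [h1, Polynomial.comp_C_mul_X_coeff, Polynomial.coeff_X_add_C_pow]
    ring
  refine ⟨(aeval ![(1 : Polynomial ℤ), Polynomial.X] F).coeff k, ?_⟩
  have h2 := congrArg (aeval ![(1 : Polynomial ℂ), Polynomial.X]) hF.2
  have h3 : aeval ![(1 : Polynomial ℂ), Polynomial.X] (MvPolynomial.map (Int.castRingHom ℂ) F) =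
      Polynomial.map (Int.castRingHom ℂ) (aeval ![(1 : Polynomial ℤ), Polynomial.X] F) := by
    have h5 : ((aeval ![(1 : Polynomial ℂ), Polynomial.X]).toRingHom.comp
        (MvPolynomial.map (Int.castRingHom ℂ)) : MvPolynomial (Fin 2) ℤ →+* Polynomial ℂ) =
        (Polynomial.mapRingHom (Int.castRingHom ℂ)).comp
          (aeval ![(1 : Polynomial ℤ), Polynomial.X]).toRingHom := by
      refine MvPolynomial.ringHom_ext (fun a => by simp) (fun i => ?_)
      fin_cases i <;> simp
    exact RingHom.congr_fun h5 F
  rw [h3] at h2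
  have h4 := congrArg (fun p => Polynomial.coeff p k) h2
  simp only [Polynomial.coeff_map, map_sub, map_pow, map_add, map_mul, aeval_X, aeval_C,
    Polynomial.coeff_sub] at h4
  simp at h4
  rw [h4, key, key]
  ring

/-- Every diagonalizable form has an associated nonzero integer `D`. -/
theorem IsDiagonalizable.exists_quadraticDiscriminant {r : ℕ} (hr : 3 ≤ r)
    {F : MvPolynomial (Fin 2) ℤ} (hF : IsDiagonalizable r F) :
    ∃ D : ℤ, D ≠ 0 ∧ IsQuadraticDiscriminant r F D := by
  obtain ⟨α, β, γ, δ, hd⟩ := hF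
  have hj := hd.1
  suffices H : ∃ (χ : ℂ) (a b c : ℤ), α * γ = χ * a ∧ α * δ + β * γ = χ * b ∧ β * δ = χ * c by
    obtain ⟨χ, a, b, c, ha, hb, hc⟩ := H
    refine ⟨b ^ 2 - 4 * a * c, fun h0 => ?_, α, β, γ, δ, χ, a, b, c, hd, ?_, rfl⟩
    · have h1 : ((b : ℂ) ^ 2 - 4 * a * c) = 0 := by exact_mod_cast h0
      apply pow_ne_zero 2 hj
      linear_combination χ ^ 2 * h1 + (α * δ + β * γ + χ * b) * hb -
        4 * (β * δ) * ha - 4 * (χ * a) * hc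
    have ha' := congrArg (C : ℂ → MvPolynomial (Fin 2) ℂ) ha
    have hb' := congrArg (C : ℂ → MvPolynomial (Fin 2) ℂ) hb
    have hc' := congrArg (C : ℂ → MvPolynomial (Fin 2) ℂ) hc
    simp only [map_mul, map_add] at ha' hb' hc'
    linear_combination X 0 ^ 2 * ha' + X 0 * X 1 * hb' + X 1 ^ 2 * hc'
  obtain ⟨n, rfl⟩ := Nat.exists_eq_add_of_le' hr
  have aux : ∀ (s t α β γ δ : ℂ), s ≠ 0 → t ≠ 0 → α * δ - β * γ ≠ 0 →
      ∀ (z : ℕ → ℤ) (w : ℕ → ℕ), (∀ k, k ≤ 3 → w k ≠ 0) →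
      (∀ k, k ≤ 3 → (z k : ℂ) = w k * (s * (α ^ (3 - k) * β ^ k) - t * (γ ^ (3 - k) * δ ^ k))) →
      ∃ (χ : ℂ) (a b c : ℤ), α * γ = χ * a ∧ α * δ + β * γ = χ * b ∧ β * δ = χ * c := by
    intro s t α β γ δ hs ht hj z w hw hz
    have z0 := hz 0 (by norm_num)
    have z1 := hz 1 (by norm_num)
    have z2 := hz 2 (by norm_num)
    have z3 := hz 3 (by norm_num)
    have w0 : (w 0 : ℂ) ≠ 0 := by exact_mod_cast hw 0 (by norm_num)
    have w1 : (w 1 : ℂ) ≠ 0 := by exact_mod_cast hw 1 (by norm_num)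
    have w2 : (w 2 : ℂ) ≠ 0 := by exact_mod_cast hw 2 (by norm_num)
    have w3 : (w 3 : ℂ) ≠ 0 := by exact_mod_cast hw 3 (by norm_num)
    set W : ℂ := -(s * t * (α * δ - β * γ) ^ 2 * (w 0 * w 1 * w 2 * w 3) ^ 2) with hW
    have hW0 : W ≠ 0 := by
      rw [hW]
      simp only [neg_ne_zero, mul_ne_zero_iff, pow_ne_zero_iff, ne_eq, OfNat.ofNat_ne_zero,
        not_false_eq_true]
      exact ⟨⟨⟨hs, ht⟩, hj⟩, ⟨⟨w0, w1⟩, w2⟩, w3⟩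
    refine ⟨W⁻¹, z 0 * z 2 * w 0 * w 2 * (w 1 * w 3) ^ 2 - (z 1) ^ 2 * (w 0 * w 2 * w 3) ^ 2,
      z 0 * z 3 * w 0 * w 3 * (w 1 * w 2) ^ 2 - z 1 * z 2 * w 1 * w 2 * (w 0 * w 3) ^ 2,
      z 1 * z 3 * w 1 * w 3 * (w 0 * w 2) ^ 2 - (z 2) ^ 2 * (w 0 * w 1 * w 3) ^ 2, ?_, ?_, ?_⟩ <;>
    · rw [eq_inv_mul_iff_mul_eq₀ hW0, hW]
      push_cast
      simp only [z0, z1, z2, z3]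
      norm_num
      ring
  choose z hz using hd.exists_coeff
  by_cases h1 : α * γ = 0
  · by_cases h2 : β * δ = 0
    · refine ⟨α * δ + β * γ, 0, 1, 0, ?_, ?_, ?_⟩ <;> simp [h1, h2]
    · obtain ⟨χ, a, b, c, ha, hb, hc⟩ := aux (β ^ n) (δ ^ n) β α δ γ
        (pow_ne_zero _ (left_ne_zero_of_mul h2)) (pow_ne_zero _ (right_ne_zero_of_mul h2))
        (by contrapose! hj; linear_combination -hj)
        (fun k => z (n + 3 - k)) (fun k => (n + 3).choose (n + 3 - k))
        (fun k hk => (Nat.choose_pos (by omega)).ne')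
        (fun k hk => by
          rw [hz, show n + 3 - (n + 3 - k) = k by omega, show n + 3 - k = n + (3 - k) by omega,
            pow_add, pow_add]
          ring)
      exact ⟨χ, c, b, a, hc, by linear_combination hb, ha⟩
  · exact aux (α ^ n) (γ ^ n) α β γ δ
      (pow_ne_zero _ (left_ne_zero_of_mul h1)) (pow_ne_zero _ (right_ne_zero_of_mul h1)) hj
      z (fun k => (n + 3).choose k) (fun k hk => (Nat.choose_pos (by omega)).ne')
      (fun k hk => by
        rw [hz, show n + 3 - k = n + (3 - k) by omega, pow_add, pow_add]
        ring)

/-! Write `ξ`, `η` for the two linear forms, `j = α δ - β γ`, and `ξ η = χ Q` with `Q` a primitive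
integral quadratic form; put `s = j / χ`, so that `s ^ 2` is the discriminant of `Q`. Since `|Δ| = r
^ r * |j| ^ (r (r - 1))`, the hypothesis on `h` says that `h` is small compared with `|j| ^ (r /
2)`.

Keep one point from each pair `±p`. For two distinct ones, `ξ(p) η(q) - ξ(q) η(p)` is `j` times a
nonzero integer. Hence at most one solution has `|ξ| ^ r < h W`, where `W = r ^ 5 |Δ| ^ ε`
(`eq_of_small`). For every other solution `η ^ r / ξ ^ r` is within `z = h / |ξ| ^ r ≤ 1 / W` of
`1`, so `η / ξ` is close to an `r`-th root of unity, its `rootClass`. Inside one class the same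
determinant forces `z₂ ≤ z₁ ^ (r - 1)` (`gap_principle`), so `m` large solutions in a class would
contain two with `z₁ ≤ W ^ (-(r - 1) ^ (m - 2))`.

The Thue-Siegel hypergeometric method excludes such a pair (`hypergeometric_method`). Padé
approximants of `x ^ (1 / r)` at `x = η₁ ^ r / ξ₁ ^ r` give a form in the two points which, suitably
scaled, is a difference of two conjugates in the quadratic order of discriminant `s ^ 2`, hence is
zero or at least `|s|` in absolute value (`norm_det_le_padeForm`). The remainder estimate makes it
too small for two consecutive degrees, so it vanishes for both, against the independence of
consecutive approximants (`pade_det_ne_zero`).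

So there are at most `1 + k (m - 1)` solutions, `k` being the number of classes
(`encard_normalizedSolutions_le`). In general `k ≤ r`. If `D > 0` then `s` is real and two classes
differ by a real root of unity, so `k ≤ 2`, and `k ≤ 1` for odd `r`; a definite form has no large
solution, since one would produce a real zero. Part (ii) is the bound `r m` for a suitable `m`. -/

/-! ### The discriminant of a diagonalizable form -/

theorem natDegree_linear_pow_le (a b : ℂ) (n : ℕ) :
    ((Polynomial.C a * Polynomial.X + Polynomial.C b) ^ n).natDegree ≤ n :=
  (Polynomial.natDegree_pow_le).trans (by
    simpa using Nat.mul_le_mul_left n (Polynomial.natDegree_linear_le (a := a) (b := b)))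

theorem norm_resultant_comm (U V : Polynomial ℂ) (n : ℕ) :
    ‖Polynomial.resultant V U n n‖ = ‖Polynomial.resultant U V n n‖ := by
  rw [Polynomial.resultant_comm]; simp

theorem norm_resultant_linear_pow_aux {a : ℂ} (ha : a ≠ 0) (b c d : ℂ) (n : ℕ) :
    ‖Polynomial.resultant ((Polynomial.C a * Polynomial.X + Polynomial.C b) ^ n)
      ((Polynomial.C c * Polynomial.X + Polynomial.C d) ^ n) n n‖ = ‖a * d - b * c‖ ^ (n * n) := by
  have h1 : (Polynomial.C a * Polynomial.X + Polynomial.C b) ^ n =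
      Polynomial.C (a ^ n) * (Polynomial.X - Polynomial.C (-b / a)) ^ n := by
    rw [map_pow, ← mul_pow, mul_sub, ← Polynomial.C_mul, mul_div_cancel₀ _ ha]
    simp
  rw [h1, Polynomial.resultant_C_mul_left,
    Polynomial.resultant_X_sub_C_pow_left _ _ _ _ (natDegree_linear_pow_le c d n)]
  simp only [Polynomial.eval_pow, Polynomial.eval_add, Polynomial.eval_mul, Polynomial.eval_C,
    Polynomial.eval_X]
  rw [← pow_mul, ← pow_mul, ← mul_pow, norm_pow]
  congr 2
  field_simp
  ring

/-- When `a = 0` the determinant condition gives `c ≠ 0`, and exchanging the arguments changes the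
resultant only by a sign. -/
theorem norm_resultant_linear_pow {a b c d : ℂ} (hj : a * d - b * c ≠ 0) (n : ℕ) :
    ‖Polynomial.resultant ((Polynomial.C a * Polynomial.X + Polynomial.C b) ^ n)
      ((Polynomial.C c * Polynomial.X + Polynomial.C d) ^ n) n n‖ = ‖a * d - b * c‖ ^ (n * n) := by
  by_cases ha : a = 0
  · have hc : c ≠ 0 := by rintro rfl; simp [ha] at hj
    rw [norm_resultant_comm, norm_resultant_linear_pow_aux hc, ← norm_neg]
    congr 2
    ring
  · exact norm_resultant_linear_pow_aux ha b c d n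

/-- Elimination: modulo the first argument the second is `((a d - b c) / a) V`, and modulo `V` the
first is `a U`; the two scalars contribute their `n`-th powers. -/
theorem norm_resultant_comb_aux {a : ℂ} (ha : a ≠ 0) (b c d : ℂ) {U V : Polynomial ℂ} {n : ℕ}
    (hU : U.natDegree ≤ n) (hV : V.natDegree ≤ n) :
    ‖Polynomial.resultant (Polynomial.C a * U + Polynomial.C b * V)
      (Polynomial.C c * U + Polynomial.C d * V) n n‖ =
      ‖a * d - b * c‖ ^ n * ‖Polynomial.resultant U V n n‖ := by
  have h1 : Polynomial.C c * U + Polynomial.C d * V = Polynomial.C ((a * d - b * c) / a) * V +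
      (Polynomial.C a * U + Polynomial.C b * V) * Polynomial.C (c / a) := by
    have e1 : (a * d - b * c) / a = d - b * (c / a) := by field_simp
    have e2 : Polynomial.C c = Polynomial.C a * Polynomial.C (c / a) := by
      rw [← Polynomial.C_mul, mul_div_cancel₀ _ ha]
    rw [e1, map_sub, map_mul, e2]
    ring
  have hd : (Polynomial.C a * U + Polynomial.C b * V).natDegree ≤ n :=
    Polynomial.natDegree_add_le_of_degree_le ((Polynomial.natDegree_C_mul_le _ _).trans hU)
      ((Polynomial.natDegree_C_mul_le _ _).trans hV)
  rw [h1, Polynomial.resultant_add_mul_right _ _ _ _ _ (by simp) hd, mul_comm (Polynomial.C b) V,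
    Polynomial.resultant_C_mul_right, Polynomial.resultant_add_mul_left _ _ _ _ _ (by simp) hV,
    Polynomial.resultant_C_mul_left, ← mul_assoc, ← mul_pow, div_mul_cancel₀ _ ha]
  simp

theorem norm_resultant_comb {a b c d : ℂ} (hj : a * d - b * c ≠ 0) {U V : Polynomial ℂ} {n : ℕ}
    (hU : U.natDegree ≤ n) (hV : V.natDegree ≤ n) :
    ‖Polynomial.resultant (Polynomial.C a * U + Polynomial.C b * V)
      (Polynomial.C c * U + Polynomial.C d * V) n n‖ =
      ‖a * d - b * c‖ ^ n * ‖Polynomial.resultant U V n n‖ := by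
  by_cases ha : a = 0
  · have hb : b ≠ 0 := by rintro rfl; simp [ha] at hj
    rw [add_comm (_ * U) (_ * V), add_comm (_ * U) (_ * V), norm_resultant_comb_aux hb _ _ _ hV hU,
      norm_resultant_comm, ← norm_neg (b * c - a * d)]
    congr 3
    ring
  · exact norm_resultant_comb_aux ha b c d hU hV

theorem map_aeval_X_one (P : MvPolynomial (Fin 2) ℤ) :
    Polynomial.map (Int.castRingHom ℂ) (aeval ![(Polynomial.X : Polynomial ℤ), 1] P) =
      aeval ![(Polynomial.X : Polynomial ℂ), 1] (MvPolynomial.map (Int.castRingHom ℂ) P) := by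
  have h5 : (Polynomial.mapRingHom (Int.castRingHom ℂ)).comp
        (aeval ![(Polynomial.X : Polynomial ℤ), 1]).toRingHom =
      ((aeval ![(Polynomial.X : Polynomial ℂ), 1]).toRingHom.comp
        (MvPolynomial.map (Int.castRingHom ℂ)) : MvPolynomial (Fin 2) ℤ →+* Polynomial ℂ) := by
    refine MvPolynomial.ringHom_ext (fun a => by simp) (fun i => ?_)
    fin_cases i <;> simp
  exact RingHom.congr_fun h5 P

/-- The partial derivatives of a diagonal form. -/
theorem IsDiagonalization.map_pderiv {r : ℕ} {F : MvPolynomial (Fin 2) ℤ} {α β γ δ : ℂ}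
    (hF : IsDiagonalization r F α β γ δ) :
    MvPolynomial.map (Int.castRingHom ℂ) (pderiv 0 F) =
      C (r : ℂ) * (C α * (C α * X 0 + C β * X 1) ^ (r - 1) -
        C γ * (C γ * X 0 + C δ * X 1) ^ (r - 1)) ∧
    MvPolynomial.map (Int.castRingHom ℂ) (pderiv 1 F) =
      C (r : ℂ) * (C β * (C α * X 0 + C β * X 1) ^ (r - 1) -
        C δ * (C γ * X 0 + C δ * X 1) ^ (r - 1)) := by
  constructor <;>
  · rw [← pderiv_map, hF.2, map_sub, Derivation.leibniz_pow, Derivation.leibniz_pow]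
    simp [pderiv_X]
    ring

/-- The partial derivatives are combinations of `ξ ^ (r - 1)` and `η ^ (r - 1)` with determinant of
norm `r ^ 2 |j|`. The resultant is thus `(r ^ 2 |j|) ^ (r - 1) * |j| ^ ((r - 1) ^ 2)` in norm, and
dividing by `r ^ (r - 2)` leaves `r ^ r`. -/
theorem IsDiagonalization.norm_formDiscr {r : ℕ} {F : MvPolynomial (Fin 2) ℤ} {α β γ δ : ℂ}
    (hr : 2 ≤ r) (hF : IsDiagonalization r F α β γ δ) :
    |(formDiscr r F : ℝ)| = (r : ℝ) ^ r * ‖α * δ - β * γ‖ ^ (r * (r - 1)) := by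
  obtain ⟨n, rfl⟩ := Nat.exists_eq_add_of_le' hr
  set U := (Polynomial.C α * Polynomial.X + Polynomial.C β) ^ (n + 1) with hU
  set V := (Polynomial.C γ * Polynomial.X + Polynomial.C δ) ^ (n + 1) with hV
  have key : |((Polynomial.resultant
      (aeval ![(Polynomial.X : Polynomial ℤ), 1] (pderiv 0 F))
      (aeval ![(Polynomial.X : Polynomial ℤ), 1] (pderiv 1 F)) (n + 1) (n + 1) : ℤ) : ℝ)| =
      ((n + 2 : ℕ) : ℝ) ^ (2 * (n + 1)) * ‖α * δ - β * γ‖ ^ ((n + 2) * (n + 1)) := by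
    rw [← Complex.norm_intCast, ← eq_intCast (Int.castRingHom ℂ), ← Polynomial.resultant_map_map,
      map_aeval_X_one, map_aeval_X_one, hF.map_pderiv.1, hF.map_pderiv.2]
    have e1 : aeval ![(Polynomial.X : Polynomial ℂ), 1]
        (C ((n + 2 : ℕ) : ℂ) * (C α * (C α * X 0 + C β * X 1) ^ (n + 2 - 1) -
        C γ * (C γ * X 0 + C δ * X 1) ^ (n + 2 - 1)) : MvPolynomial (Fin 2) ℂ) =
        Polynomial.C (((n + 2 : ℕ) : ℂ) * α) * U + Polynomial.C (-((n + 2 : ℕ) : ℂ) * γ) * V := by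
      simp [hU, hV, Polynomial.algebraMap_eq]
      ring
    have e2 : aeval ![(Polynomial.X : Polynomial ℂ), 1]
        (C ((n + 2 : ℕ) : ℂ) * (C β * (C α * X 0 + C β * X 1) ^ (n + 2 - 1) -
        C δ * (C γ * X 0 + C δ * X 1) ^ (n + 2 - 1)) : MvPolynomial (Fin 2) ℂ) =
        Polynomial.C (((n + 2 : ℕ) : ℂ) * β) * U + Polynomial.C (-((n + 2 : ℕ) : ℂ) * δ) * V := by
      simp [hU, hV, Polynomial.algebraMap_eq]
      ring
    have hd : ((n + 2 : ℕ) : ℂ) * α * (-((n + 2 : ℕ) : ℂ) * δ) -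
        -((n + 2 : ℕ) : ℂ) * γ * (((n + 2 : ℕ) : ℂ) * β) =
        -(((n + 2 : ℕ) : ℂ) ^ 2 * (α * δ - β * γ)) := by ring
    rw [e1, e2, norm_resultant_comb _ (natDegree_linear_pow_le _ _ _)
      (natDegree_linear_pow_le _ _ _), norm_resultant_linear_pow hF.1, hd, norm_neg,
      norm_mul, norm_pow, Complex.norm_natCast]
    · ring
    · rw [hd, neg_ne_zero]
      exact mul_ne_zero (pow_ne_zero _ (Nat.cast_ne_zero.2 (by omega))) hF.1
  rw [formDiscr, show n + 2 - 1 = n + 1 from rfl, show n + 2 - 2 = n from rfl]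
  push_cast
  rw [abs_div, abs_mul, abs_pow, abs_neg, abs_one, one_pow, one_mul, key, abs_of_pos (by positivity),
    div_eq_iff (by positivity)]
  push_cast
  ring

/-! ### Padé approximants of `x ^ ν` at `1` -/

/-- The generalized binomial coefficient `x (x - 1) ⋯ (x - k + 1) / k!`. -/
noncomputable def genChoose (x : ℝ) (k : ℕ) : ℝ := ∏ i ∈ Finset.range k, (x - i) / (i + 1)

theorem genChoose_zero (x : ℝ) : genChoose x 0 = 1 := by simp [genChoose]

theorem genChoose_succ (x : ℝ) (k : ℕ) :
    genChoose x (k + 1) = genChoose x k * ((x - k) / (k + 1)) := by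
  rw [genChoose, genChoose, Finset.prod_range_succ]

theorem genChoose_natCast (n k : ℕ) : genChoose n k = n.choose k := by
  induction k with
  | zero => simp [genChoose_zero]
  | succ k ih =>
    rw [genChoose_succ, ih, mul_div_assoc', div_eq_iff (by positivity)]
    rcases le_or_gt k n with h | h
    · have := Nat.choose_succ_right_eq n k
      rw [← Nat.cast_sub h]
      exact_mod_cast this.symm
    · simp [Nat.choose_eq_zero_of_lt h, Nat.choose_eq_zero_of_lt (h.trans (Nat.lt_succ_self k))]

theorem genChoose_nonneg {x : ℝ} {k : ℕ} (h : (k : ℝ) ≤ x + 1) : 0 ≤ genChoose x k := by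
  refine Finset.prod_nonneg fun i hi => div_nonneg ?_ (by positivity)
  have : (i : ℝ) + 1 ≤ k := by exact_mod_cast Finset.mem_range.1 hi
  linarith

theorem genChoose_pos {x : ℝ} {k : ℕ} (h : (k : ℝ) < x + 1) : 0 < genChoose x k := by
  refine Finset.prod_pos fun i hi => div_pos ?_ (by positivity)
  have : (i : ℝ) + 1 ≤ k := by exact_mod_cast Finset.mem_range.1 hi
  linarith

theorem genChoose_mono {x y : ℝ} {k : ℕ} (h : (k : ℝ) ≤ x + 1) (hxy : x ≤ y) :
    genChoose x k ≤ genChoose y k := by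
  refine Finset.prod_le_prod (fun i hi => div_nonneg ?_ (by positivity)) fun i hi => ?_
  · have : (i : ℝ) + 1 ≤ k := by exact_mod_cast Finset.mem_range.1 hi
    linarith
  · gcongr

/-- Checked one prime `p` at a time. If `p ∣ r`, Legendre's formula bounds the exponent of `p` in
`k!` by `k`, so `r ^ k` suffices. Otherwise `r` has an inverse `v` modulo `p ^ j`, and multiplying
the factors by `-v` turns them into the consecutive integers `-v a + i`. -/
theorem factorial_dvd_pow_mul_prod (r : ℕ) (a : ℤ) (k : ℕ) :
    (k.factorial : ℤ) ∣ (r : ℤ) ^ k * ∏ i ∈ Finset.range k, (a - i * r) := by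
  rw [Int.natCast_dvd, Nat.dvd_iff_prime_pow_dvd_dvd]
  intro p j hp hpj
  rw [← Int.natCast_dvd]
  by_cases hpr : p ∣ r
  · have := Fact.mk hp
    have h1 : j ≤ padicValNat p k.factorial :=
      (padicValNat_dvd_iff_le k.factorial_ne_zero).1 hpj
    have h2 := sub_one_mul_padicValNat_factorial (p := p) k
    have h3 : padicValNat p k.factorial ≤ (p - 1) * padicValNat p k.factorial :=
      Nat.le_mul_of_pos_left _ (by have := hp.two_le; omega)
    have h4 : p ^ j ∣ r ^ k := (pow_dvd_pow p (by omega)).trans (pow_dvd_pow_of_dvd hpr k)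
    exact Dvd.dvd.mul_right (by exact_mod_cast h4) _
  · have hc : IsCoprime ((p ^ j : ℕ) : ℤ) (r : ℤ) :=
      Nat.isCoprime_iff_coprime.2 (Nat.Coprime.pow_left j ((hp.coprime_iff_not_dvd).2 hpr))
    obtain ⟨u, v, huv⟩ := hc
    have hv : IsCoprime ((p ^ j : ℕ) : ℤ) (v ^ k) :=
      IsCoprime.pow_right ⟨u, r, by linear_combination huv⟩
    refine Dvd.dvd.mul_left (hv.dvd_of_dvd_mul_left ?_) _
    have h1 : ((p ^ j : ℕ) : ℤ) ∣ ∏ i ∈ Finset.range k, (-(v * a) + i) :=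
      (Int.natCast_dvd_natCast.2 hpj).trans (Nat.factorial_coe_dvd_prod k _)
    have h2 : ∏ i ∈ Finset.range k, (-(v * a) + i) ≡
        ∏ i ∈ Finset.range k, (-(v * (a - i * r))) [ZMOD ((p ^ j : ℕ) : ℤ)] := by
      refine Int.ModEq.prod fun i _ => ?_
      rw [Int.modEq_iff_dvd]
      exact ⟨-(i * u), by linear_combination (i : ℤ) * huv⟩
    have h3 := (Int.ModEq.dvd_iff h2).1 h1
    rw [Finset.prod_neg, Finset.prod_mul_distrib, Finset.prod_const, Finset.card_range] at h3
    exact (IsUnit.dvd_mul_left ((isUnit_one.neg).pow k)).1 h3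

/-- One factor `r ^ k` clears the denominator of `a / r`, the other pays for `k!`. -/
theorem exists_int_genChoose {r : ℕ} (hr : r ≠ 0) (a : ℤ) (k : ℕ) :
    ∃ z : ℤ, (r : ℝ) ^ (2 * k) * genChoose (a / r) k = z := by
  obtain ⟨z, hz⟩ := factorial_dvd_pow_mul_prod r a k
  refine ⟨z, ?_⟩
  have h1 : genChoose (a / r) k * ((r : ℝ) ^ k * k.factorial) =
      ∏ i ∈ Finset.range k, ((a : ℝ) - i * r) := by
    induction k generalizing z with
    | zero => simp [genChoose_zero]
    | succ k ih =>
      obtain ⟨z', hz'⟩ := factorial_dvd_pow_mul_prod r a k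
      rw [Finset.prod_range_succ, ← ih z' hz', genChoose_succ, Nat.factorial_succ]
      have : (r : ℝ) ≠ 0 := by exact_mod_cast hr
      push_cast
      field_simp
      ring
  have h2 : (r : ℝ) ^ k * ∏ i ∈ Finset.range k, ((a : ℝ) - i * r) = k.factorial * z := by
    exact_mod_cast congrArg (Int.cast : ℤ → ℝ) hz
  have h3 : (k.factorial : ℝ) ≠ 0 := by exact_mod_cast k.factorial_ne_zero
  rw [← h1] at h2
  apply mul_left_cancel₀ h3
  linear_combination h2

/-- Coefficients of the Padé approximants of `x ^ ν`. -/
noncomputable def padeCoeff (ν : ℝ) (n k : ℕ) : ℝ := genChoose (n + ν) k * genChoose (n - ν) (n - k)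

theorem padeCoeff_neg (ν : ℝ) {n k : ℕ} (h : k ≤ n) :
    padeCoeff (-ν) n k = padeCoeff ν n (n - k) := by
  rw [padeCoeff, padeCoeff, Nat.sub_sub_self h, sub_neg_eq_add, ← sub_eq_add_neg, mul_comm]

/-- This two-term recurrence is the coefficientwise form of the differential equation
`padePoly_ode`. -/
theorem padeCoeff_succ (ν : ℝ) {n k : ℕ} (h : k < n) :
    (k + 1) * (k + 1 - ν) * padeCoeff ν n (k + 1) = (k - n) * (k - n - ν) * padeCoeff ν n k := by
  obtain ⟨m, rfl⟩ := Nat.exists_eq_add_of_lt h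
  rw [padeCoeff, padeCoeff, genChoose_succ, show k + m + 1 - (k + 1) = m by omega,
    show k + m + 1 - k = m + 1 by omega, genChoose_succ]
  have h1 : (k : ℝ) + 1 ≠ 0 := by positivity
  have h2 : (m : ℝ) + 1 ≠ 0 := by positivity
  push_cast
  field_simp
  ring

theorem padeCoeff_nonneg {ν : ℝ} (h : |ν| ≤ 1) {n k : ℕ} (hk : k ≤ n) : 0 ≤ padeCoeff ν n k := by
  have := abs_le.1 h
  have hk' : (k : ℝ) ≤ n := by exact_mod_cast hk
  refine mul_nonneg (genChoose_nonneg (by linarith)) (genChoose_nonneg ?_)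
  rw [Nat.cast_sub hk]
  have : (0 : ℝ) ≤ k := by positivity
  linarith

theorem exists_int_padeCoeff {r : ℕ} (hr : r ≠ 0) (e : ℤ) {n k : ℕ} (hk : k ≤ n) :
    ∃ z : ℤ, (r : ℝ) ^ (2 * n) * padeCoeff (e / r) n k = z := by
  have hr' : (r : ℝ) ≠ 0 := by exact_mod_cast hr
  obtain ⟨z1, h1⟩ := exists_int_genChoose hr (n * r + e) k
  obtain ⟨z2, h2⟩ := exists_int_genChoose hr (n * r - e) (n - k)
  refine ⟨z1 * z2, ?_⟩
  rw [padeCoeff, show 2 * n = 2 * k + 2 * (n - k) by omega, pow_add]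
  push_cast at h1 h2 ⊢
  rw [← h1, ← h2, add_div, sub_div, mul_div_assoc, div_self hr', mul_one]
  ring

/-- The factors are at most `C(n + 1, k) ≤ 2 ^ (n + 1)` and `C(n, k)`, and the latter sum to `2 ^
n`. -/
theorem sum_padeCoeff_le {ν : ℝ} (h0 : 0 ≤ ν) (h1 : ν ≤ 1) (n : ℕ) :
    ∑ k ∈ Finset.range (n + 1), padeCoeff ν n k ≤ 2 * 4 ^ n := by
  have hle : ∀ k ∈ Finset.range (n + 1), padeCoeff ν n k ≤ 2 ^ (n + 1) * (n.choose k : ℝ) := by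
    intro k hk
    have hk : k ≤ n := Nat.lt_succ_iff.1 (Finset.mem_range.1 hk)
    have hk' : (k : ℝ) ≤ n := by exact_mod_cast hk
    have hk0 : (0 : ℝ) ≤ k := by positivity
    have e1 : genChoose (n + ν) k ≤ 2 ^ (n + 1) := by
      refine (genChoose_mono (y := ((n + 1 : ℕ) : ℝ)) (by linarith) (by push_cast; linarith)).trans
        ?_
      rw [genChoose_natCast]
      exact_mod_cast Nat.choose_le_two_pow (n + 1) k
    have e2 : genChoose (n - ν) (n - k) ≤ n.choose k := by
      refine (genChoose_mono (y := (n : ℝ)) ?_ (by linarith)).trans ?_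
      · rw [Nat.cast_sub hk]; linarith
      · rw [genChoose_natCast, Nat.choose_symm hk]
    exact mul_le_mul e1 e2 (genChoose_nonneg (by rw [Nat.cast_sub hk]; linarith)) (by positivity)
  refine (Finset.sum_le_sum hle).trans ?_
  rw [← Finset.mul_sum, ← Nat.cast_sum, Nat.sum_range_choose]
  push_cast
  rw [show (4 : ℝ) = 2 * 2 by norm_num, mul_pow]
  exact le_of_eq (by ring)

/-- The numerator `∑ C(n + ν, k) C(n - ν, n - k) x ^ k` of the Padé approximant; the denominator
is obtained by changing the sign of `ν`. -/
noncomputable def padePoly (ν : ℝ) (n : ℕ) : Polynomial ℝ :=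
  ∑ k ∈ Finset.range (n + 1), Polynomial.C (padeCoeff ν n k) * Polynomial.X ^ k

theorem coeff_padePoly (ν : ℝ) (n k : ℕ) :
    (padePoly ν n).coeff k = if k ≤ n then padeCoeff ν n k else 0 := by
  simp [padePoly, Polynomial.coeff_X_pow]

theorem natDegree_padePoly_le (ν : ℝ) (n : ℕ) : (padePoly ν n).natDegree ≤ n := by
  rw [Polynomial.natDegree_le_iff_coeff_eq_zero]
  intro k hk
  rw [coeff_padePoly, if_neg (by omega)]

open Polynomial in
/-- The hypergeometric differential equation. -/
theorem padePoly_ode (ν : ℝ) (n : ℕ) :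
    Polynomial.X * (1 - Polynomial.X) * derivative (derivative (padePoly ν n)) +
      (Polynomial.C (1 - ν) - Polynomial.C (1 - 2 * n - ν) * Polynomial.X) *
        derivative (padePoly ν n) - Polynomial.C (n * (n + ν)) * padePoly ν n = 0 := by
  ext k
  have hrec : ((k : ℝ) + 1) * (k + 1 - ν) * (padePoly ν n).coeff (k + 1) =
      (k - n) * (k - n - ν) * (padePoly ν n).coeff k := by
    rw [coeff_padePoly, coeff_padePoly]
    rcases lt_trichotomy k n with h | h | h
    · rw [if_pos (by omega), if_pos (by omega), padeCoeff_succ ν h]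
    · subst h; simp
    · rw [if_neg (by omega), if_neg (by omega)]; simp
  have e : Polynomial.X * (1 - Polynomial.X) * derivative (derivative (padePoly ν n)) +
      (Polynomial.C (1 - ν) - Polynomial.C (1 - 2 * n - ν) * Polynomial.X) *
        derivative (padePoly ν n) - Polynomial.C (n * (n + ν)) * padePoly ν n =
      Polynomial.X * derivative (derivative (padePoly ν n)) -
      Polynomial.X * (Polynomial.X * derivative (derivative (padePoly ν n))) +
      Polynomial.C (1 - ν) * derivative (padePoly ν n) -
      Polynomial.C (1 - 2 * n - ν) * (Polynomial.X * derivative (padePoly ν n)) -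
      Polynomial.C (n * (n + ν)) * padePoly ν n := by ring
  rw [e]
  rcases k with _ | _ | k
  all_goals
    simp only [Polynomial.coeff_C_zero, Polynomial.coeff_sub, Polynomial.coeff_add,
      Polynomial.coeff_C_mul, Polynomial.mul_coeff_zero, Polynomial.coeff_X_zero,
      Polynomial.coeff_X_mul,
      coeff_derivative, Polynomial.coeff_zero, zero_mul] at hrec ⊢
    push_cast at hrec ⊢
    linear_combination hrec

-- Translating by `1` gives Euler's equation `X q' = m q`, which kills every coefficient except that
-- of `X ^ m`.
open Polynomial in
theorem eq_C_mul_one_sub_X_pow {P : Polynomial ℝ} {m : ℕ}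
    (h : (1 - Polynomial.X) * derivative P = -(Polynomial.C (m : ℝ) * P)) :
    ∃ c : ℝ, P = Polynomial.C c * (Polynomial.X - 1) ^ m := by
  set q := P.comp (Polynomial.X + 1) with hq
  have h1 : Polynomial.X * derivative q = Polynomial.C (m : ℝ) * q := by
    have h2 := congrArg (fun p => p.comp (Polynomial.X + 1)) h
    simp only [mul_comp, sub_comp, neg_comp, one_comp, X_comp, C_comp] at h2
    rw [hq, derivative_comp]
    simp only [derivative_add, derivative_X, derivative_one, add_zero]
    linear_combination -h2
  have h3 : ∀ k, k ≠ m → q.coeff k = 0 := by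
    intro k hk
    have h4 := congrArg (fun p => p.coeff k) h1
    rcases k with _ | k
    · simp only [Polynomial.mul_coeff_zero, Polynomial.coeff_X_zero, zero_mul,
        Polynomial.coeff_C_zero] at h4
      have : (m : ℝ) ≠ 0 := by exact_mod_cast hk.symm
      simpa [this] using h4.symm
    · simp only [Polynomial.coeff_X_mul, coeff_derivative, Polynomial.coeff_C_mul] at h4
      have : ((k + 1 : ℕ) : ℝ) - m ≠ 0 := sub_ne_zero.2 (by exact_mod_cast hk)
      apply (mul_eq_zero.1 (_ : (((k + 1 : ℕ) : ℝ) - m) * q.coeff (k + 1) = 0)).resolve_left this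
      push_cast
      linear_combination h4
  refine ⟨q.coeff m, ?_⟩
  have h5 : q = Polynomial.C (q.coeff m) * Polynomial.X ^ m := by
    ext k
    rw [Polynomial.coeff_C_mul, Polynomial.coeff_X_pow]
    split_ifs with hk
    · rw [hk, mul_one]
    · rw [h3 k hk, mul_zero]
  have h6 : P = q.comp (Polynomial.X - 1) := by
    rw [hq, comp_assoc]; simp
  conv_lhs => rw [h6, h5]
  simp

open Polynomial in
/-- The Wronskian of the Padé numerator and `x ^ ν` times the denominator, up to a power of `x`. -/
theorem exists_pade_wronskian (ν : ℝ) (n : ℕ) :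
    ∃ c : ℝ, Polynomial.X * (padePoly ν n * derivative (padePoly (-ν) n) -
      derivative (padePoly ν n) * padePoly (-ν) n) +
        Polynomial.C ν * (padePoly ν n * padePoly (-ν) n) =
      Polynomial.C c * (Polynomial.X - 1) ^ (2 * n) := by
  apply eq_C_mul_one_sub_X_pow
  have hA := padePoly_ode ν n
  have hB := padePoly_ode (-ν) n
  simp only [map_sub, map_add, map_mul, map_one, map_neg, map_natCast, map_ofNat,
    derivative_mul, derivative_X, derivative_C, Nat.cast_mul, Nat.cast_ofNat]
    at hA hB ⊢
  linear_combination padePoly ν n * hB - padePoly (-ν) n * hA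

/-! ### Order of vanishing and size of the Padé remainder. -/

open Filter Topology Metric Asymptotics in
/-- A function whose derivative vanishes to order `k` differs from its value by `O((x - c)^(k+1))`. -/
theorem isBigO_sub_pow_succ_of_hasDerivAt {h g : ℂ → ℂ} {c : ℂ} {k : ℕ}
    (hd : ∀ᶠ x in 𝓝 c, HasDerivAt h (g x) x) (hg : g =O[𝓝 c] fun x => (x - c) ^ k) :
    (fun x => h x - h c) =O[𝓝 c] fun x => (x - c) ^ (k + 1) := by
  obtain ⟨M, hM⟩ := hg.bound
  obtain ⟨e, he, hb⟩ := Metric.eventually_nhds_iff_ball.1 (hd.and hM)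
  refine IsBigO.of_bound M (Metric.eventually_nhds_iff_ball.2 ⟨e, he, fun x hx => ?_⟩)
  have hsub : closedBall c ‖x - c‖ ⊆ ball c e := by
    intro y hy
    rw [mem_closedBall] at hy
    rw [mem_ball, dist_eq_norm] at hx
    exact mem_ball.2 (hy.trans_lt hx)
  have hxm : x ∈ closedBall c ‖x - c‖ := by rw [mem_closedBall, dist_eq_norm]
  by_cases hxc : x = c
  · simp [hxc]
  have hM0 : 0 ≤ M := by
    have h1 := (hb x hx).2
    have h2 : 0 < ‖(x - c) ^ k‖ := norm_pos_iff.2 (pow_ne_zero _ (sub_ne_zero.2 hxc))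
    exact nonneg_of_mul_nonneg_left ((norm_nonneg _).trans h1) h2
  have := (convex_closedBall c ‖x - c‖).norm_image_sub_le_of_norm_hasDerivWithin_le
    (f := h) (f' := g) (C := M * ‖x - c‖ ^ k)
    (fun y hy => ((hb y (hsub hy)).1).hasDerivWithinAt)
    (fun y hy => ((hb y (hsub hy)).2).trans (by
      rw [norm_pow]
      rw [mem_closedBall, dist_eq_norm] at hy
      gcongr)) (mem_closedBall_self (norm_nonneg _)) hxm
  refine this.trans (le_of_eq ?_)
  rw [norm_pow]
  ring

open Filter Topology Metric Asymptotics in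
/-- The Schwarz lemma for a zero of order `N`. -/
theorem norm_le_mul_pow_of_isBigO {f : ℂ → ℂ} {c : ℂ} {R M : ℝ} (hR : 0 < R) {N : ℕ}
    (hd : DifferentiableOn ℂ f (ball c R)) (hM : ∀ x ∈ ball c R, ‖f x‖ ≤ M)
    (ho : f =O[𝓝 c] fun x => (x - c) ^ N) {x : ℂ} (hx : x ∈ ball c R) :
    ‖f x‖ ≤ M * (‖x - c‖ / R) ^ N := by
  induction N generalizing f M with
  | zero => simpa using hM x hx
  | succ N ih =>
    have hfc : f c = 0 := by
      obtain ⟨K, hK⟩ := ho.bound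
      simpa using hK.self_of_nhds
    have hc : ball c R ∈ 𝓝 c := ball_mem_nhds c hR
    have hg : DifferentiableOn ℂ (dslope f c) (ball c R) :=
      (Complex.differentiableOn_dslope hc).2 hd
    have hfg : ∀ y, f y = (y - c) * dslope f c y := by
      intro y
      have := sub_smul_dslope f c y
      rw [hfc, sub_zero, smul_eq_mul] at this
      exact this.symm
    have hgM : ∀ y ∈ ball c R, ‖dslope f c y‖ ≤ M / R := fun y hy =>
      Complex.norm_dslope_le_div_of_mapsTo_ball hd
        (fun w hw => by rw [hfc, mem_closedBall, dist_zero_right]; exact hM w hw) hy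
    have hgo : dslope f c =O[𝓝 c] fun x => (x - c) ^ N := by
      obtain ⟨K, hK⟩ := ho.bound
      have h1 : ∀ᶠ y in 𝓝[≠] c, ‖dslope f c y‖ ≤ K * ‖(y - c) ^ N‖ := by
        filter_upwards [hK.filter_mono nhdsWithin_le_nhds, self_mem_nhdsWithin] with y hy hyc
        have h2 : 0 < ‖y - c‖ := norm_pos_iff.2 (sub_ne_zero.2 hyc)
        rw [hfg y, pow_succ', norm_mul, norm_mul] at hy
        refine le_of_mul_le_mul_left ?_ h2
        linarith
      -- The estimate was obtained by dividing by `y - c`; at `y = c` it follows by continuity of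
      -- the slope.
      have hcont : ContinuousAt (dslope f c) c :=
        (hg c (mem_ball_self hR)).continuousWithinAt.continuousAt hc
      refine IsBigO.of_bound K ?_
      rw [← nhdsNE_sup_pure, eventually_sup]
      refine ⟨h1, ?_⟩
      rw [eventually_pure]
      refine le_of_tendsto_of_tendsto (b := 𝓝[≠] c)
        (hcont.norm.tendsto.mono_left nhdsWithin_le_nhds) ?_ h1
      exact ((by fun_prop : Continuous fun y : ℂ => K * ‖(y - c) ^ N‖).tendsto c).mono_left
        nhdsWithin_le_nhds
    rw [hfg x, norm_mul]
    refine (mul_le_mul_of_nonneg_left (ih hg hgM hgo) (norm_nonneg _)).trans (le_of_eq ?_)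
    rw [pow_succ]
    field_simp

-- If the multiplicity `k` were below `N`, the cofactor of `(y - c) ^ k` would tend to `0` at `c`,
-- where it does not vanish.
open Filter Topology Asymptotics in
theorem X_sub_C_pow_dvd_of_isBigO {P : Polynomial ℂ} {c : ℂ} {N : ℕ} (hP : P ≠ 0)
    (ho : (fun x => P.eval x) =O[𝓝 c] fun x => (x - c) ^ N) :
    (Polynomial.X - Polynomial.C c) ^ N ∣ P := by
  obtain ⟨q, hq, hqc⟩ := P.exists_eq_pow_rootMultiplicity_mul_and_not_dvd hP c
  set k := P.rootMultiplicity c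
  by_cases hk : N ≤ k
  · rw [hq]
    exact (pow_dvd_pow _ hk).mul_right _
  exfalso
  obtain ⟨m, hm⟩ := Nat.exists_eq_add_of_lt (not_le.1 hk)
  obtain ⟨K, hK⟩ := ho.bound
  have h1 : ∀ᶠ y in 𝓝[≠] c, ‖q.eval y‖ ≤ K * ‖(y - c) ^ (m + 1)‖ := by
    filter_upwards [hK.filter_mono nhdsWithin_le_nhds, self_mem_nhdsWithin] with y hy hyc
    have h2 : 0 < ‖(y - c) ^ k‖ := norm_pos_iff.2 (pow_ne_zero _ (sub_ne_zero.2 hyc))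
    rw [hm, hq, add_assoc, pow_add, norm_mul] at hy
    simp only [Polynomial.eval_mul, Polynomial.eval_pow, Polynomial.eval_sub, Polynomial.eval_X,
      Polynomial.eval_C, norm_mul] at hy
    refine le_of_mul_le_mul_left ?_ h2
    linarith
  apply hqc
  rw [Polynomial.dvd_iff_isRoot, Polynomial.IsRoot.def, ← norm_le_zero_iff]
  have h2 : Tendsto (fun y : ℂ => K * ‖(y - c) ^ (m + 1)‖) (𝓝[≠] c) (𝓝 0) := by
    have := ((by fun_prop : Continuous fun y : ℂ => K * ‖(y - c) ^ (m + 1)‖).tendsto c).mono_left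
      (nhdsWithin_le_nhds (s := {c}ᶜ))
    simpa using this
  exact le_of_tendsto_of_tendsto (q.continuous.norm.tendsto c |>.mono_left nhdsWithin_le_nhds)
    h2 h1

open Filter Topology Asymptotics in
/-- A nonzero polynomial of degree at most `N` vanishing to order `N` at `c` has no other root. -/
theorem eval_ne_zero_of_isBigO {P : Polynomial ℂ} {c : ℂ} {N : ℕ} (hP : P ≠ 0)
    (hdeg : P.natDegree ≤ N) (ho : (fun x => P.eval x) =O[𝓝 c] fun x => (x - c) ^ N) {x : ℂ}
    (hx : x ≠ c) : P.eval x ≠ 0 := by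
  obtain ⟨q, hq⟩ := X_sub_C_pow_dvd_of_isBigO hP ho
  have hq0 : q ≠ 0 := by rintro rfl; simp [hq] at hP
  have hd : P.natDegree = N + q.natDegree := by
    conv_lhs => rw [hq]
    rw [((Polynomial.monic_X_sub_C c).pow N).natDegree_mul' hq0]
    simp
  obtain ⟨a, ha⟩ := Polynomial.natDegree_eq_zero.1 (by omega : q.natDegree = 0)
  have ha0 : a ≠ 0 := by rintro rfl; simp at ha; exact hq0 ha.symm
  rw [hq, ← ha]
  simpa [ha0] using fun h => absurd (sub_eq_zero.1 h) hx

theorem genChoose_succ_succ (x : ℝ) (k : ℕ) :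
    genChoose (x + 1) (k + 1) = genChoose x k * ((x + 1) / (k + 1)) := by
  induction k with
  | zero => simp [genChoose]
  | succ k ih =>
    rw [genChoose_succ, ih, genChoose_succ]
    push_cast
    field_simp
    ring

/-- The value of the Padé numerator at a complex number. -/
noncomputable def padeEval (ν : ℝ) (n : ℕ) (x : ℂ) : ℂ := Polynomial.aeval x (padePoly ν n)

theorem padeEval_eq_sum (ν : ℝ) (n : ℕ) (x : ℂ) :
    padeEval ν n x = ∑ k ∈ Finset.range (n + 1), (padeCoeff ν n k : ℂ) * x ^ k := by
  simp [padeEval, padePoly]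

theorem padeEval_neg_eq_sum (ν : ℝ) (n : ℕ) (x : ℂ) :
    padeEval (-ν) n x = ∑ k ∈ Finset.range (n + 1), (padeCoeff ν n k : ℂ) * x ^ (n - k) := by
  rw [padeEval_eq_sum, ← Finset.sum_flip]
  refine Finset.sum_congr rfl fun k hk => ?_
  have hk : k ≤ n := Nat.lt_succ_iff.1 (Finset.mem_range.1 hk)
  rw [padeCoeff_neg ν (Nat.sub_le n k), Nat.sub_sub_self hk]

theorem padeEval_neg_one (ν : ℝ) (n : ℕ) : padeEval (-ν) n 1 = padeEval ν n 1 := by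
  rw [padeEval_neg_eq_sum, padeEval_eq_sum]; simp

theorem sum_padeCoeff_le_of_abs {ν : ℝ} (h1 : |ν| ≤ 1) (n : ℕ) :
    ∑ k ∈ Finset.range (n + 1), padeCoeff ν n k ≤ 2 * 4 ^ n := by
  have h2 := abs_le.1 h1
  rcases le_total 0 ν with h | h
  · exact sum_padeCoeff_le h h2.2 n
  · rw [← Finset.sum_flip]
    refine (Finset.sum_congr rfl fun k hk => ?_).trans_le
      (sum_padeCoeff_le (ν := -ν) (by linarith) (by linarith) n)
    rw [padeCoeff_neg ν (Nat.lt_succ_iff.1 (Finset.mem_range.1 hk))]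

theorem norm_padeEval_le {ν : ℝ} (h1 : |ν| ≤ 1) (n : ℕ) {x : ℂ} (hx : ‖x‖ ≤ 3 / 2) :
    ‖padeEval ν n x‖ ≤ 2 * 6 ^ n := by
  rw [padeEval_eq_sum]
  have : ∀ k ∈ Finset.range (n + 1), ‖(padeCoeff ν n k : ℂ) * x ^ k‖ ≤
      padeCoeff ν n k * (3 / 2) ^ n := by
    intro k hk
    have hk : k ≤ n := Nat.lt_succ_iff.1 (Finset.mem_range.1 hk)
    rw [norm_mul, norm_pow, Complex.norm_real, Real.norm_of_nonneg (padeCoeff_nonneg h1 hk)]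
    refine mul_le_mul_of_nonneg_left ?_ (padeCoeff_nonneg h1 hk)
    exact (pow_le_pow_left₀ (norm_nonneg _) hx k).trans (pow_le_pow_right₀ (by norm_num) hk)
  refine (norm_sum_le_of_le _ this).trans ?_
  rw [← Finset.sum_mul]
  refine (mul_le_mul_of_nonneg_right (sum_padeCoeff_le_of_abs h1 n) (by positivity)).trans ?_
  rw [mul_assoc, ← mul_pow]
  norm_num

theorem padeEval_one_ne_zero {ν : ℝ} (h1 : |ν| < 1) (n : ℕ) : padeEval ν n 1 ≠ 0 := by
  rw [padeEval_eq_sum]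
  simp only [one_pow, mul_one]
  rw [← Complex.ofReal_sum, Complex.ofReal_ne_zero]
  refine (Finset.sum_pos' (fun k hk => padeCoeff_nonneg h1.le
    (Nat.lt_succ_iff.1 (Finset.mem_range.1 hk))) ⟨0, by simp, ?_⟩).ne'
  have := abs_lt.1 h1
  rw [padeCoeff, genChoose_zero, one_mul]
  exact genChoose_pos (by rw [Nat.sub_zero]; linarith)

theorem differentiable_padeEval (ν : ℝ) (n : ℕ) : Differentiable ℂ (padeEval ν n) :=
  (padePoly ν n).differentiable_aeval

-- By the Wronskian identity the quotient `x ^ ν B / A` has derivative `c x ^ (ν - 1) (x - 1) ^ (2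
-- n) / A ^ 2`, and its value at `1` is `1`; integrating gains the extra order.
open Filter Topology Asymptotics in
theorem isBigO_pade {ν : ℝ} (h1 : |ν| < 1) (n : ℕ) :
    (fun x : ℂ => padeEval ν n x - x ^ (ν : ℂ) * padeEval (-ν) n x) =O[𝓝 1]
      fun x => (x - 1) ^ (2 * n + 1) := by
  obtain ⟨c, hc⟩ := exists_pade_wronskian ν n
  set A := padeEval ν n with hA
  set B := padeEval (-ν) n with hB
  set A' : ℂ → ℂ := fun x => Polynomial.aeval x (Polynomial.derivative (padePoly ν n)) with hA'
  set B' : ℂ → ℂ := fun x => Polynomial.aeval x (Polynomial.derivative (padePoly (-ν) n)) with hB'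
  have hdA : ∀ x, HasDerivAt A (A' x) x := fun x => (padePoly ν n).hasDerivAt_aeval x
  have hdB : ∀ x, HasDerivAt B (B' x) x := fun x => (padePoly (-ν) n).hasDerivAt_aeval x
  have hW : ∀ x : ℂ, x * (A x * B' x - A' x * B x) + ν * (A x * B x) =
      c * (x - 1) ^ (2 * n) := by
    intro x
    have := congrArg (fun p => Polynomial.aeval x p) hc
    simpa [hA, hB, hA', hB', padeEval] using this
  have hA1 : A 1 ≠ 0 := padeEval_one_ne_zero h1 n
  have hne : ∀ᶠ x in 𝓝 (1 : ℂ), A x ≠ 0 :=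
    (hdA 1).continuousAt.eventually_ne hA1
  have hsl : ∀ᶠ x in 𝓝 (1 : ℂ), x ∈ Complex.slitPlane :=
    Complex.isOpen_slitPlane.mem_nhds Complex.one_mem_slitPlane
  have hcpow : ∀ a : ℂ, ContinuousAt (fun x : ℂ => x ^ a) 1 := fun a =>
    continuousAt_cpow_const Complex.one_mem_slitPlane
  have key := isBigO_sub_pow_succ_of_hasDerivAt (c := 1) (k := 2 * n)
    (h := fun x => x ^ (ν : ℂ) * B x / A x)
    (g := fun x => x ^ ((ν : ℂ) - 1) * c / A x ^ 2 * (x - 1) ^ (2 * n)) ?_ ?_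
  · have h2 : (fun x : ℂ => -A x * (x ^ (ν : ℂ) * B x / A x - 1 ^ (ν : ℂ) * B 1 / A 1)) =O[𝓝 1]
        fun x => 1 * (x - 1) ^ (2 * n + 1) :=
      IsBigO.mul ((hdA 1).continuousAt.neg.tendsto.isBigO_one ℂ) key
    refine (h2.congr' ?_ ?_)
    · filter_upwards [hne] with x hx
      have : B 1 = A 1 := padeEval_neg_one ν n
      rw [this, Complex.one_cpow, one_mul, div_self hA1]
      field_simp
      ring
    · simp
  · filter_upwards [hne, hsl] with x hx hxs
    have hx0 : x ≠ 0 := Complex.slitPlane_ne_zero hxs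
    have hp : HasDerivAt (fun x : ℂ => x ^ (ν : ℂ)) ((ν : ℂ) * x ^ ((ν : ℂ) - 1)) x :=
      (Complex.hasStrictDerivAt_cpow_const hxs).hasDerivAt
    convert! ((hp.mul (hdB x)).div (hdA x) hx) using 1
    have e : x ^ (ν : ℂ) = x ^ ((ν : ℂ) - 1) * x := by
      rw [Complex.cpow_sub _ _ hx0, Complex.cpow_one]; field_simp
    simp only [Pi.mul_apply, e]
    rw [div_mul_eq_mul_div, div_left_inj' (pow_ne_zero 2 hx)]
    linear_combination -(x ^ ((ν : ℂ) - 1)) * hW x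
  · have : (fun x : ℂ => x ^ ((ν : ℂ) - 1) * c / A x ^ 2) =O[𝓝 1] fun _ => (1 : ℂ) := by
      refine Tendsto.isBigO_one ℂ (ContinuousAt.tendsto (x := (1 : ℂ)) ?_)
      exact ((hcpow _).mul continuousAt_const).div ((hdA 1).continuousAt.pow 2)
        (pow_ne_zero 2 hA1)
    simpa using this.mul (isBigO_refl (fun x : ℂ => (x - 1) ^ (2 * n)) (𝓝 1))

theorem norm_cpow_le_of_norm_le {ν : ℝ} (h0 : 0 ≤ ν) (h1 : ν ≤ 1) {x : ℂ} (hx : ‖x‖ ≤ 3 / 2) :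
    ‖x ^ (ν : ℂ)‖ ≤ 3 / 2 := by
  rw [Complex.norm_cpow_real]
  calc ‖x‖ ^ ν ≤ (3 / 2 : ℝ) ^ ν := Real.rpow_le_rpow (norm_nonneg _) hx h0
    _ ≤ (3 / 2 : ℝ) ^ (1 : ℝ) := Real.rpow_le_rpow_of_exponent_le (by norm_num) h1
    _ = 3 / 2 := Real.rpow_one _

/-- Schwarz's lemma on the disc of radius `1 / 2`. There the function is at most `(1 + 3 / 2) * 2 *
6 ^ n = 5 * 6 ^ n`, and the radius contributes `2 ^ (2 n + 1) = 2 * 4 ^ n`. -/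
theorem norm_pade_remainder_le {ν : ℝ} (h0 : 0 ≤ ν) (h1 : ν < 1) (n : ℕ) {x : ℂ}
    (hx : ‖x - 1‖ < 1 / 2) :
    ‖padeEval ν n x - x ^ (ν : ℂ) * padeEval (-ν) n x‖ ≤ 10 * 24 ^ n * ‖x - 1‖ ^ (2 * n + 1) := by
  have habs : |ν| < 1 := by rw [abs_of_nonneg h0]; exact h1
  have hball : ∀ y ∈ Metric.ball (1 : ℂ) (1 / 2), ‖y‖ ≤ 3 / 2 := by
    intro y hy
    rw [Metric.mem_ball, dist_eq_norm] at hy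
    calc ‖y‖ = ‖(y - 1) + 1‖ := by rw [sub_add_cancel]
      _ ≤ ‖y - 1‖ + ‖(1 : ℂ)‖ := norm_add_le _ _
      _ ≤ 3 / 2 := by rw [norm_one]; linarith
  have hslit : ∀ y ∈ Metric.ball (1 : ℂ) (1 / 2), y ∈ Complex.slitPlane := by
    intro y hy
    rw [Metric.mem_ball, dist_eq_norm] at hy
    left
    have := (Complex.abs_re_le_norm (y - 1)).trans_lt hy
    rw [abs_lt, Complex.sub_re, Complex.one_re] at this
    linarith
  refine (norm_le_mul_pow_of_isBigO (R := 1 / 2) (M := 5 * 6 ^ n) (by norm_num) ?_ ?_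
    (isBigO_pade habs n) (by rwa [Metric.mem_ball, dist_eq_norm])).trans (le_of_eq ?_)
  · exact (differentiable_padeEval ν n).differentiableOn.sub
      ((differentiableOn_id.cpow_const hslit).mul (differentiable_padeEval (-ν) n).differentiableOn)
  · intro y hy
    refine (norm_sub_le _ _).trans ?_
    rw [norm_mul]
    have e1 := norm_padeEval_le habs.le n (hball y hy)
    have e2 := norm_padeEval_le (ν := -ν) (by rw [abs_neg]; exact habs.le) n (hball y hy)
    have e3 := norm_cpow_le_of_norm_le h0 h1.le (hball y hy)
    have e4 := mul_le_mul e3 e2 (norm_nonneg _) (by norm_num)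
    linarith
  · rw [show (24 : ℝ) = 6 * 4 by norm_num, mul_pow, div_pow, show (4 : ℝ) = 2 ^ 2 by norm_num,
      ← pow_mul, one_div, inv_pow, pow_succ 2]
    field_simp
    ring

open Filter Topology Asymptotics in
/-- Consecutive Padé approximants are linearly independent away from `1`. -/
theorem pade_det_ne_zero {ν : ℝ} (h0 : 0 < ν) (h1 : ν < 1) (n : ℕ) {x : ℂ} (hx : x ≠ 1) :
    padeEval ν n x * padeEval (-ν) (n + 1) x - padeEval ν (n + 1) x * padeEval (-ν) n x ≠ 0 := by
  set P : Polynomial ℝ := padePoly ν n * padePoly (-ν) (n + 1) - padePoly ν (n + 1) * padePoly (-ν) n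
    with hP
  have habs : |ν| < 1 := by rw [abs_of_pos h0]; exact h1
  have heval : ∀ y : ℂ, (P.map (algebraMap ℝ ℂ)).eval y =
      padeEval ν n y * padeEval (-ν) (n + 1) y - padeEval ν (n + 1) y * padeEval (-ν) n y := by
    intro y
    rw [Polynomial.eval_map_algebraMap, hP, map_sub, map_mul, map_mul]
    rfl
  rw [← heval]
  have hdeg : P.natDegree ≤ 2 * n + 1 := by
    refine (Polynomial.natDegree_sub_le _ _).trans (max_le ?_ ?_)
    · refine Polynomial.natDegree_mul_le.trans ?_
      have := natDegree_padePoly_le ν n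
      have := natDegree_padePoly_le (-ν) (n + 1)
      omega
    · refine Polynomial.natDegree_mul_le.trans ?_
      have := natDegree_padePoly_le ν (n + 1)
      have := natDegree_padePoly_le (-ν) n
      omega
  refine eval_ne_zero_of_isBigO (N := 2 * n + 1) (c := 1) ?_ ?_ ?_ hx
  · rw [Ne, Polynomial.map_eq_zero]
    intro hP0
    have h2 := congrArg (fun p => Polynomial.coeff p 0) hP0
    -- The determinant is a nonzero polynomial because its constant coefficient is the product of
    -- these two binomials with `2 ν / (n + 1)`.
    have hp : 0 < genChoose (n - ν) n := genChoose_pos (by linarith)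
    have hq : 0 < genChoose (n + ν) n := genChoose_pos (by linarith)
    have e1 : genChoose (((n + 1 : ℕ) : ℝ) - ν) (n + 1) =
        genChoose (n - ν) n * ((n - ν + 1) / (n + 1)) := by
      rw [← genChoose_succ_succ]; congr 1; push_cast; ring
    have e2 : genChoose (((n + 1 : ℕ) : ℝ) + ν) (n + 1) =
        genChoose (n + ν) n * ((n + ν + 1) / (n + 1)) := by
      rw [← genChoose_succ_succ]; congr 1; push_cast; ring
    simp only [hP, Polynomial.coeff_sub, Polynomial.mul_coeff_zero, coeff_padePoly, zero_le,
      if_true, padeCoeff, genChoose_zero, one_mul, Nat.sub_zero, sub_neg_eq_add,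
      Polynomial.coeff_zero, e1, e2] at h2
    have h3 : genChoose (n - ν) n * genChoose (n + ν) n * (2 * ν / (n + 1)) = 0 := by
      rw [← h2]; field_simp; ring
    have h4 : 0 < genChoose (n - ν) n * genChoose (n + ν) n * (2 * ν / (n + 1)) := by positivity
    exact h4.ne' h3
  · exact (Polynomial.natDegree_map_le).trans hdeg
  -- Eliminating `x ^ ν` between the two remainders shows that the determinant vanishes to order `2
  -- n + 1` at `1`, which is also the bound for its degree.
  · have hB : ∀ m, padeEval (-ν) m =O[𝓝 (1 : ℂ)] fun _ => (1 : ℂ) := fun m =>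
      ((differentiable_padeEval (-ν) m).continuous.tendsto 1).isBigO_one ℂ
    have g1 := (isBigO_pade habs n).mul (hB (n + 1))
    have g2 := ((isBigO_pade habs (n + 1)).mul (hB n))
    have g3 : (fun x : ℂ => (x - 1) ^ (2 * (n + 1) + 1)) =O[𝓝 1]
        fun x => (x - 1) ^ (2 * n + 1) := by
      have : (fun x : ℂ => (x - 1) ^ 2) =O[𝓝 1] fun _ => (1 : ℂ) :=
        ((by fun_prop : Continuous fun x : ℂ => (x - 1) ^ 2).tendsto 1).isBigO_one ℂ
      refine (this.mul (isBigO_refl (fun x : ℂ => (x - 1) ^ (2 * n + 1)) (𝓝 1))).congr ?_ ?_ <;>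
        intro x <;> ring
    simp only [mul_one] at g1 g2
    refine (g1.sub (g2.trans g3)).congr_left fun x => ?_
    rw [heval]
    ring

/-- The homogeneous form of the Padé numerator. -/
noncomputable def padeForm (ν : ℝ) (n : ℕ) (x y : ℂ) : ℂ :=
  ∑ k ∈ Finset.range (n + 1), (padeCoeff ν n k : ℂ) * (x ^ k * y ^ (n - k))

theorem padeForm_eq (ν : ℝ) (n : ℕ) {x y : ℂ} (hx : x ≠ 0) :
    padeForm ν n y x = x ^ n * padeEval ν n (y / x) := by
  rw [padeForm, padeEval_eq_sum, Finset.mul_sum]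
  refine Finset.sum_congr rfl fun k hk => ?_
  have hk : k ≤ n := Nat.lt_succ_iff.1 (Finset.mem_range.1 hk)
  rw [div_pow, ← Nat.sub_add_cancel hk, pow_add, Nat.add_sub_cancel]
  field_simp

theorem padeForm_swap_eq (ν : ℝ) (n : ℕ) {x y : ℂ} (hx : x ≠ 0) :
    padeForm ν n x y = x ^ n * padeEval (-ν) n (y / x) := by
  rw [padeForm, padeEval_neg_eq_sum, Finset.mul_sum]
  refine Finset.sum_congr rfl fun k hk => ?_
  have hk : k ≤ n := Nat.lt_succ_iff.1 (Finset.mem_range.1 hk)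
  obtain ⟨m, rfl⟩ := Nat.exists_eq_add_of_le hk
  rw [Nat.add_sub_cancel_left, div_pow, pow_add]
  field_simp

/-! ### Arithmetic of diagonal forms -/

/-- `u` and `u'` are `p + q τ` and `p + q τ'` with integers `p, q`, where `τ = (D + s) / 2` and
`τ' = (D - s) / 2`. For `s = √D` with `D` not a square, these are conjugate elements of the
quadratic order of discriminant `D`. -/
def IsConjPair (D : ℤ) (s u u' : ℂ) : Prop :=
  ∃ p q : ℤ, u = p + q * ((D + s) / 2) ∧ u' = p + q * ((D - s) / 2)

namespace IsConjPair

variable {D : ℤ} {s u u' v v' : ℂ}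

theorem intCast (n : ℤ) : IsConjPair D s n n := ⟨n, 0, by simp, by simp⟩

theorem zero : IsConjPair D s 0 0 := by simpa using intCast (D := D) (s := s) 0

theorem one : IsConjPair D s 1 1 := by simpa using intCast (D := D) (s := s) 1

theorem symm (h : IsConjPair D s u u') : IsConjPair D s u' u := by
  obtain ⟨p, q, rfl, rfl⟩ := h
  exact ⟨p + q * D, -q, by push_cast; ring, by push_cast; ring⟩

theorem add (h : IsConjPair D s u u') (k : IsConjPair D s v v') :
    IsConjPair D s (u + v) (u' + v') := by
  obtain ⟨p, q, rfl, rfl⟩ := h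
  obtain ⟨p', q', rfl, rfl⟩ := k
  exact ⟨p + p', q + q', by push_cast; ring, by push_cast; ring⟩

/-- The hypothesis `D ^ 2 ≡ D` modulo `4` makes the norm `(D ^ 2 - D) / 4` of `τ` an integer. -/
theorem exists_norm (h0 : ∃ k : ℤ, D ^ 2 - D = 4 * k) (hs : s ^ 2 = D)
    (h : IsConjPair D s u u') : ∃ z : ℤ, u * u' = z := by
  obtain ⟨k, hk⟩ := h0
  obtain ⟨p, q, rfl, rfl⟩ := h
  have hk' : (D : ℂ) ^ 2 - D = 4 * k := by exact_mod_cast congrArg (Int.cast : ℤ → ℂ) hk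
  refine ⟨p ^ 2 + p * q * D + q ^ 2 * k, ?_⟩
  push_cast
  linear_combination (q ^ 2 / 4 : ℂ) * hk' - (q ^ 2 / 4 : ℂ) * hs

theorem mul (h0 : ∃ k : ℤ, D ^ 2 - D = 4 * k) (hs : s ^ 2 = D) (h : IsConjPair D s u u')
    (k : IsConjPair D s v v') : IsConjPair D s (u * v) (u' * v') := by
  obtain ⟨m, hm⟩ := h0
  obtain ⟨p, q, rfl, rfl⟩ := h
  obtain ⟨p', q', rfl, rfl⟩ := k
  have hm' : (D : ℂ) ^ 2 - D = 4 * m := by exact_mod_cast congrArg (Int.cast : ℤ → ℂ) hm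
  refine ⟨p * p' - q * q' * m, p * q' + p' * q + q * q' * D, ?_, ?_⟩
  · push_cast
    linear_combination (q * q' / 4 : ℂ) * hs - (q * q' / 4 : ℂ) * hm'
  · push_cast
    linear_combination (q * q' / 4 : ℂ) * hs - (q * q' / 4 : ℂ) * hm'

theorem pow (h0 : ∃ k : ℤ, D ^ 2 - D = 4 * k) (hs : s ^ 2 = D) (h : IsConjPair D s u u') (n : ℕ) :
    IsConjPair D s (u ^ n) (u' ^ n) := by
  induction n with
  | zero => simpa using one
  | succ n ih => rw [pow_succ, pow_succ]; exact ih.mul h0 hs h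

theorem sum {ι : Type*} (t : Finset ι) {f g : ι → ℂ} (h : ∀ i ∈ t, IsConjPair D s (f i) (g i)) :
    IsConjPair D s (∑ i ∈ t, f i) (∑ i ∈ t, g i) := by
  classical
  induction t using Finset.induction_on with
  | empty => simpa using zero
  | insert i t hi ih =>
    rw [Finset.sum_insert hi, Finset.sum_insert hi]
    exact (h i (Finset.mem_insert_self i t)).add
      (ih fun j hj => h j (Finset.mem_insert_of_mem hj))

/-- The difference is `q s` with an integer `q ≠ 0`. This is the only lower bound of the method, and
it does not depend on the sign of `D` or on `D` being a nonsquare. -/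
theorem norm_le_norm_sub (h : IsConjPair D s u u') (hne : u ≠ u') : ‖s‖ ≤ ‖u - u'‖ := by
  obtain ⟨p, q, rfl, rfl⟩ := h
  have e : (p : ℂ) + q * ((D + s) / 2) - (p + q * ((D - s) / 2)) = q * s := by ring
  have hq : q ≠ 0 := by rintro rfl; simp at hne
  rw [e, norm_mul, Complex.norm_intCast]
  have : (1 : ℝ) ≤ |(q : ℝ)| := by exact_mod_cast Int.one_le_abs hq
  nlinarith [norm_nonneg s]

end IsConjPair

/-! ### Integrality attached to a diagonalization. -/

/-- A diagonalization together with a primitive quadratic form proportional to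
`(α x + β y) (γ x + δ y)`. -/
structure IsPrimitiveDiagonalization (r : ℕ) (F : MvPolynomial (Fin 2) ℤ) (α β γ δ χ : ℂ)
    (a b c : ℤ) : Prop where
  diag : IsDiagonalization r F α β γ δ
  mul_left : α * γ = χ * a
  mul_mid : α * δ + β * γ = χ * b
  mul_right : β * δ = χ * c
  coprime : ∃ u v w : ℤ, u * a + v * b + w * c = 1

/-- The common divisor of the coefficients is absorbed into `χ`; it changes `D` by a square, so the
sign survives. Primitivity is what `exists_int_mul_pow` needs. -/
theorem IsQuadraticDiscriminant.exists_primitive {r : ℕ} {F : MvPolynomial (Fin 2) ℤ} {D : ℤ}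
    (hD : IsQuadraticDiscriminant r F D) :
    ∃ (α β γ δ χ : ℂ) (a b c g : ℤ), IsPrimitiveDiagonalization r F α β γ δ χ a b c ∧
      D = g ^ 2 * (b ^ 2 - 4 * a * c) := by
  obtain ⟨α, β, γ, δ, χ, a, b, c, hd, hQ, rfl⟩ := hD
  have hv : ∀ x y : ℂ, (α * x + β * y) * (γ * x + δ * y) =
      χ * (a * x ^ 2 + b * x * y + c * y ^ 2) := by
    intro x y
    have := congrArg (eval ![x, y]) hQ
    simpa using this
  have h1 : α * γ = χ * a := by simpa using hv 1 0
  have h3 : β * δ = χ * c := by simpa using hv 0 1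
  have h2 : α * δ + β * γ = χ * b := by
    have := hv 1 1
    simp only [mul_one, one_pow] at this
    linear_combination this - h1 - h3
  set g : ℤ := gcd a (gcd b c) with hg
  have hg0 : g ≠ 0 := by
    intro h0
    rw [hg, gcd_eq_zero_iff, gcd_eq_zero_iff] at h0
    obtain ⟨rfl, rfl, rfl⟩ := h0
    apply hd.1
    have hj : (α * δ - β * γ) ^ 2 = 0 := by
      simp only [Int.cast_zero, mul_zero] at h1 h2 h3
      linear_combination (α * δ + β * γ) * h2 - 4 * β * δ * h1
    exact pow_eq_zero_iff (two_ne_zero) |>.1 hj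
  obtain ⟨a', ha⟩ : g ∣ a := gcd_dvd_left _ _
  obtain ⟨b', hb⟩ : g ∣ b := (gcd_dvd_right _ _).trans (gcd_dvd_left _ _)
  obtain ⟨c', hc⟩ : g ∣ c := (gcd_dvd_right _ _).trans (gcd_dvd_right _ _)
  refine ⟨α, β, γ, δ, χ * g, a', b', c', g, ⟨hd, ?_, ?_, ?_, ?_⟩, ?_⟩
  · rw [h1, ha]; push_cast; ring
  · rw [h2, hb]; push_cast; ring
  · rw [h3, hc]; push_cast; ring
  · obtain ⟨u, v, huv⟩ := exists_gcd_eq_mul_add_mul a (gcd b c)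
    obtain ⟨u', v', huv'⟩ := exists_gcd_eq_mul_add_mul b c
    refine ⟨u, v * u', v * v', ?_⟩
    apply mul_left_cancel₀ hg0
    have : g = a * u + gcd b c * v := huv
    rw [huv'] at this
    linear_combination -this - u * ha - v * u' * hb - v * v' * hc
  · rw [ha, hb, hc]; ring

/-- The linear form `a x + b y`. -/
noncomputable def linForm (a b : ℂ) (p : ℤ × ℤ) : ℂ := a * p.1 + b * p.2

theorem eval_intCast (P : MvPolynomial (Fin 2) ℤ) (p : ℤ × ℤ) :
    ((eval ![p.1, p.2] P : ℤ) : ℂ) =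
      eval ![(p.1 : ℂ), (p.2 : ℂ)] (MvPolynomial.map (Int.castRingHom ℂ) P) := by
  have h : (Int.castRingHom ℂ).comp (eval ![p.1, p.2]) =
      (eval ![(p.1 : ℂ), (p.2 : ℂ)]).comp (MvPolynomial.map (Int.castRingHom ℂ)) := by
    refine MvPolynomial.ringHom_ext (fun a => by simp) (fun i => ?_)
    fin_cases i <;> simp
  exact RingHom.congr_fun h P

theorem aeval_ofReal (P : MvPolynomial (Fin 2) ℤ) (v : Fin 2 → ℝ) :
    ((aeval v P : ℝ) : ℂ) =
      eval ![(v 0 : ℂ), (v 1 : ℂ)] (MvPolynomial.map (Int.castRingHom ℂ) P) := by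
  have h : Complex.ofRealHom.comp (aeval v : MvPolynomial (Fin 2) ℤ →ₐ[ℤ] ℝ).toRingHom =
      (eval ![(v 0 : ℂ), (v 1 : ℂ)]).comp (MvPolynomial.map (Int.castRingHom ℂ)) := by
    refine MvPolynomial.ringHom_ext (fun a => by simp) (fun i => ?_)
    fin_cases i <;> simp
  exact RingHom.congr_fun h P

theorem IsDiagonalization.eval_eq {r : ℕ} {F : MvPolynomial (Fin 2) ℤ} {α β γ δ : ℂ}
    (hF : IsDiagonalization r F α β γ δ) (p : ℤ × ℤ) :
    ((eval ![p.1, p.2] F : ℤ) : ℂ) = linForm α β p ^ r - linForm γ δ p ^ r := by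
  rw [eval_intCast, hF.2]
  simp [linForm]

theorem IsDiagonalization.eval_pderiv {r : ℕ} {F : MvPolynomial (Fin 2) ℤ} {α β γ δ : ℂ}
    (hF : IsDiagonalization r F α β γ δ) (p : ℤ × ℤ) :
    ((eval ![p.1, p.2] (pderiv 0 F) : ℤ) : ℂ) =
      r * (α * linForm α β p ^ (r - 1) - γ * linForm γ δ p ^ (r - 1)) ∧
    ((eval ![p.1, p.2] (pderiv 1 F) : ℤ) : ℂ) =
      r * (β * linForm α β p ^ (r - 1) - δ * linForm γ δ p ^ (r - 1)) := by
  rw [eval_intCast, eval_intCast, hF.map_pderiv.1, hF.map_pderiv.2]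
  simp [linForm]

theorem exists_two_mul_eq_sq_sub (b : ℤ) : ∃ k : ℤ, b ^ 2 - b = 2 * k := by
  obtain ⟨k, hk⟩ := Int.even_mul_pred_self b
  exact ⟨k, by linear_combination hk⟩

theorem exists_discr_sq_sub (a b c : ℤ) :
    ∃ k : ℤ, (b ^ 2 - 4 * a * c) ^ 2 - (b ^ 2 - 4 * a * c) = 4 * k := by
  obtain ⟨m, hm⟩ := exists_two_mul_eq_sq_sub b
  exact ⟨m * (m + b) - 2 * b ^ 2 * a * c + 4 * (a * c) ^ 2 + a * c,
    by linear_combination (b ^ 2 + b + 2 * m) * hm⟩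

namespace IsPrimitiveDiagonalization

variable {r : ℕ} {F : MvPolynomial (Fin 2) ℤ} {α β γ δ χ : ℂ} {a b c : ℤ}

theorem chi_ne_zero (H : IsPrimitiveDiagonalization r F α β γ δ χ a b c) : χ ≠ 0 := by
  rintro rfl
  apply H.diag.1
  have h1 := H.mul_left
  have h2 := H.mul_mid
  simp only [zero_mul] at h1 h2
  exact pow_eq_zero_iff (two_ne_zero) |>.1
    (by linear_combination (α * δ + β * γ) * h2 - 4 * β * δ * h1 :
      (α * δ - β * γ) ^ 2 = 0)

theorem chi_mul_s (H : IsPrimitiveDiagonalization r F α β γ δ χ a b c) :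
    χ * ((α * δ - β * γ) / χ) = α * δ - β * γ := mul_div_cancel₀ _ H.chi_ne_zero

theorem s_sq (H : IsPrimitiveDiagonalization r F α β γ δ χ a b c) :
    ((α * δ - β * γ) / χ) ^ 2 = ((b ^ 2 - 4 * a * c : ℤ) : ℂ) := by
  have := H.chi_ne_zero
  rw [div_pow, div_eq_iff (pow_ne_zero 2 this)]
  push_cast
  linear_combination (α * δ + β * γ + χ * b) * H.mul_mid - 4 * β * δ * H.mul_left
    - 4 * χ * a * H.mul_right

theorem s_ne_zero (H : IsPrimitiveDiagonalization r F α β γ δ χ a b c) :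
    (α * δ - β * γ) / χ ≠ 0 := div_ne_zero H.diag.1 H.chi_ne_zero

/-- Over `χ`, the sum of the two products is the polar form of `Q`, an integer, and their difference
is `s` times the determinant of the points. The halves are integral because `b ^ 2 - b` is even. -/
theorem isConjPair_cross (H : IsPrimitiveDiagonalization r F α β γ δ χ a b c) (p q : ℤ × ℤ) :
    IsConjPair (b ^ 2 - 4 * a * c) ((α * δ - β * γ) / χ)
      (linForm α β p * linForm γ δ q / χ) (linForm α β q * linForm γ δ p / χ) := by
  have hχ := H.chi_ne_zero
  obtain ⟨k, hk⟩ := exists_two_mul_eq_sq_sub b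
  have hk' : (b : ℂ) ^ 2 - b = 2 * k := by exact_mod_cast congrArg (Int.cast : ℤ → ℂ) hk
  have e1 : α * δ = χ * b - β * γ := by linear_combination H.mul_mid
  refine ⟨a * p.1 * q.1 + c * p.2 * q.2 + (2 * a * c - k) * p.1 * q.2 +
    (k + b - 2 * a * c) * q.1 * p.2, p.1 * q.2 - q.1 * p.2, ?_, ?_⟩
  · rw [div_eq_iff hχ, linForm, linForm]
    push_cast
    have e2 := H.chi_mul_s
    set s := (α * δ - β * γ) / χ
    linear_combination (p.1 * q.1 : ℂ) * H.mul_left + (p.2 * q.2 : ℂ) * H.mul_right +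
      ((p.1 * q.2 + q.1 * p.2) / 2 : ℂ) * H.mul_mid - ((p.1 * q.2 - q.1 * p.2) / 2 : ℂ) * e2 -
      (χ * (p.1 * q.2 - q.1 * p.2) / 2 : ℂ) * hk'
  · rw [div_eq_iff hχ, linForm, linForm]
    push_cast
    have e2 := H.chi_mul_s
    set s := (α * δ - β * γ) / χ
    linear_combination (p.1 * q.1 : ℂ) * H.mul_left + (p.2 * q.2 : ℂ) * H.mul_right +
      ((p.1 * q.2 + q.1 * p.2) / 2 : ℂ) * H.mul_mid + ((p.1 * q.2 - q.1 * p.2) / 2 : ℂ) * e2 -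
      (χ * (p.1 * q.2 - q.1 * p.2) / 2 : ℂ) * hk'

theorem linForm_mul (H : IsPrimitiveDiagonalization r F α β γ δ χ a b c) (p : ℤ × ℤ) :
    linForm α β p * linForm γ δ p =
      χ * ((a * p.1 ^ 2 + b * p.1 * p.2 + c * p.2 ^ 2 : ℤ) : ℂ) := by
  rw [linForm, linForm]
  push_cast
  linear_combination (p.1 ^ 2 : ℂ) * H.mul_left + (p.1 * p.2 : ℂ) * H.mul_mid +
    (p.2 ^ 2 : ℂ) * H.mul_right

/-- The difference is `s r F(p)`, which Euler's identity rewrites by the partial derivatives. The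
sum `r s (ξ ^ r + η ^ r)` is the Jacobian `F_x Q_y - F_y Q_x`, an integer of the required parity. -/
theorem isConjPair_pow (hr : 1 ≤ r) (H : IsPrimitiveDiagonalization r F α β γ δ χ a b c)
    (p : ℤ × ℤ) :
    IsConjPair (b ^ 2 - 4 * a * c) ((α * δ - β * γ) / χ)
      (r * ((α * δ - β * γ) / χ) * linForm α β p ^ r)
      (r * ((α * δ - β * γ) / χ) * linForm γ δ p ^ r) := by
  obtain ⟨k, hk⟩ := exists_two_mul_eq_sq_sub b
  have hk' : (b : ℂ) ^ 2 - b = 2 * k := by exact_mod_cast congrArg (Int.cast : ℤ → ℂ) hk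
  obtain ⟨n, rfl⟩ := Nat.exists_eq_add_of_le' hr
  obtain ⟨hx, hy⟩ := H.diag.eval_pderiv p
  have hF := H.diag.eval_eq p
  set fx := eval ![p.1, p.2] (pderiv 0 F)
  set fy := eval ![p.1, p.2] (pderiv 1 F)
  set f := eval ![p.1, p.2] F
  rw [Nat.add_sub_cancel] at hx hy
  have euler : ((n + 1 : ℕ) : ℂ) * f = p.1 * fx + p.2 * fy := by
    rw [hF, hx, hy, pow_succ, pow_succ]
    have e1 : linForm α β p = α * p.1 + β * p.2 := rfl
    have e2 : linForm γ δ p = γ * p.1 + δ * p.2 := rfl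
    linear_combination ((n + 1 : ℕ) : ℂ) * linForm α β p ^ n * e1 -
      ((n + 1 : ℕ) : ℂ) * linForm γ δ p ^ n * e2
  have hj := H.chi_mul_s
  have hχ := H.chi_ne_zero
  set s := (α * δ - β * γ) / χ
  have ht : ((n + 1 : ℕ) : ℂ) * s * (linForm α β p ^ (n + 1) + linForm γ δ p ^ (n + 1)) =
      fx * (b * p.1 + 2 * c * p.2) - fy * (2 * a * p.1 + b * p.2) := by
    apply mul_left_cancel₀ hχ
    have q1 : χ * (b * p.1 + 2 * c * p.2) = β * linForm γ δ p + δ * linForm α β p := by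
      rw [linForm, linForm]
      linear_combination -(p.1 : ℂ) * H.mul_mid - 2 * (p.2 : ℂ) * H.mul_right
    have q2 : χ * (2 * a * p.1 + b * p.2) = α * linForm γ δ p + γ * linForm α β p := by
      rw [linForm, linForm]
      linear_combination -2 * (p.1 : ℂ) * H.mul_left - (p.2 : ℂ) * H.mul_mid
    have : χ * (fx * (b * p.1 + 2 * c * p.2) - fy * (2 * a * p.1 + b * p.2)) =
        fx * (χ * (b * p.1 + 2 * c * p.2)) - fy * (χ * (2 * a * p.1 + b * p.2)) := by ring
    rw [this, q1, q2, hx, hy]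
    linear_combination ((n + 1 : ℕ) : ℂ) * (linForm α β p ^ (n + 1) + linForm γ δ p ^ (n + 1)) * hj
  have hm : ∃ m : ℤ, (fx * (b * p.1 + 2 * c * p.2) - fy * (2 * a * p.1 + b * p.2) -
      (p.1 * fx + p.2 * fy) * (b ^ 2 - 4 * a * c) : ℂ) = 2 * m := by
    refine ⟨fx * c * p.2 - fy * a * p.1 + 2 * (p.1 * fx + p.2 * fy) * a * c - p.1 * fx * k
      - p.2 * fy * (k + b), ?_⟩
    push_cast
    linear_combination -(p.1 * fx + p.2 * fy : ℂ) * hk'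
  obtain ⟨m, hm⟩ := hm
  refine ⟨m, p.1 * fx + p.2 * fy, ?_, ?_⟩
  · push_cast at euler ht hF ⊢
    linear_combination ht / 2 + hm / 2 + (s / 2) * euler - ((n : ℂ) + 1) * s / 2 * hF
  · push_cast at euler ht hF ⊢
    linear_combination ht / 2 + hm / 2 - (s / 2) * euler + ((n : ℂ) + 1) * s / 2 * hF

/-- With `y` the quantity in question, the norm of the pair in `isConjPair_pow` shows that `y Q(p) ^
r` is an integer for every `p`. The integers `n` with `n y` integral form an ideal containing the
`r`-th powers of `Q(1, 0)`, `Q(0, 1)`, `Q(1, 1)`; these values generate the unit ideal, and so do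
their powers. -/
theorem exists_int_mul_pow (hr : 1 ≤ r) (H : IsPrimitiveDiagonalization r F α β γ δ χ a b c) :
    ∃ N : ℤ, N ≠ 0 ∧ (r : ℂ) ^ 2 * ((α * δ - β * γ) / χ) ^ 2 * χ ^ r = N := by
  set y := (r : ℂ) ^ 2 * ((α * δ - β * γ) / χ) ^ 2 * χ ^ r with hy
  have hy0 : y ≠ 0 := mul_ne_zero (mul_ne_zero (pow_ne_zero _ (by exact_mod_cast (by omega)))
    (pow_ne_zero _ H.s_ne_zero)) (pow_ne_zero _ H.chi_ne_zero)
  have hv : ∀ p : ℤ × ℤ, ∃ z : ℤ, ((a * p.1 ^ 2 + b * p.1 * p.2 + c * p.2 ^ 2 : ℤ) : ℂ) ^ r * y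
      = z := by
    intro p
    obtain ⟨z, hz⟩ := (H.isConjPair_pow hr p).exists_norm (exists_discr_sq_sub a b c) H.s_sq
    refine ⟨z, ?_⟩
    rw [← hz, hy]
    have := congrArg (· ^ r) (H.linForm_mul p)
    simp only [mul_pow] at this
    linear_combination -(r : ℂ) ^ 2 * ((α * δ - β * γ) / χ) ^ 2 * this
  let J : Ideal ℤ := Submodule.comap (LinearMap.toSpanSingleton ℤ ℂ y)
    (LinearMap.range (Algebra.linearMap ℤ ℂ))
  have hJ : ∀ n : ℤ, (∃ z : ℤ, (n : ℂ) * y = z) → n ∈ J := by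
    rintro n ⟨z, hz⟩
    exact ⟨z, by simp [← hz]⟩
  have hspan : Ideal.span {a, c, a + b + c} = ⊤ := by
    rw [Ideal.eq_top_iff_one]
    obtain ⟨u, v, w, h⟩ := H.coprime
    have : (1 : ℤ) = (u - v) * a + (w - v) * c + v * (a + b + c) := by linear_combination -h
    rw [this]
    refine add_mem (add_mem ?_ ?_) ?_ <;> refine Ideal.mul_mem_left _ _ (Ideal.subset_span ?_) <;>
      simp
  have hone : (1 : ℤ) ∈ J := by
    have htop := Ideal.span_pow_eq_top _ hspan r
    have hle : Ideal.span ((fun x => x ^ r) '' {a, c, a + b + c}) ≤ J := by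
      rw [Ideal.span_le]
      rintro _ ⟨x, hx, rfl⟩
      apply hJ
      simp only [Set.mem_insert_iff, Set.mem_singleton_iff] at hx
      rcases hx with rfl | rfl | rfl
      · simpa using hv (1, 0)
      · simpa using hv (0, 1)
      · simpa using hv (1, 1)
    exact hle (htop ▸ Submodule.mem_top)
  obtain ⟨N, hN⟩ := hone
  have hN' : y = N := by simpa using hN.symm
  refine ⟨N, ?_, hN'⟩
  rintro rfl
  exact hy0 (by simpa using hN')

/-- The square root of the quadratic discriminant is bounded in terms of the determinant. -/
theorem norm_s_pow_le (hr : 2 ≤ r) (H : IsPrimitiveDiagonalization r F α β γ δ χ a b c) :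
    ‖(α * δ - β * γ) / χ‖ ^ (r - 2) ≤ (r : ℝ) ^ 2 * ‖α * δ - β * γ‖ ^ r := by
  obtain ⟨N, hN, hy⟩ := H.exists_int_mul_pow (by omega)
  have h1 : (1 : ℝ) ≤ (r : ℝ) ^ 2 * ‖(α * δ - β * γ) / χ‖ ^ 2 * ‖χ‖ ^ r := by
    have := congrArg norm hy
    rw [norm_mul, norm_mul, norm_pow, norm_pow, norm_pow, Complex.norm_natCast,
      Complex.norm_intCast] at this
    rw [this]
    exact_mod_cast Int.one_le_abs hN
  have h2 : ‖χ‖ * ‖(α * δ - β * γ) / χ‖ = ‖α * δ - β * γ‖ := by rw [← norm_mul, H.chi_mul_s]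
  have hs : 0 < ‖(α * δ - β * γ) / χ‖ := norm_pos_iff.2 H.s_ne_zero
  obtain ⟨n, rfl⟩ := Nat.exists_eq_add_of_le' hr
  rw [← h2, mul_pow, Nat.add_sub_cancel]
  set σ := ‖(α * δ - β * γ) / χ‖
  calc σ ^ n = 1 * σ ^ n := (one_mul _).symm
    _ ≤ (((n + 2 : ℕ) : ℝ) ^ 2 * σ ^ 2 * ‖χ‖ ^ (n + 2)) * σ ^ n := by gcongr
    _ = _ := by ring

/-- The factor `r ^ (2 n)` makes the Padé coefficients integral; the remaining `(r s) ^ n` is spread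
over the `n` factors `ξ ^ r`, `η ^ r`, and conjugation exchanges `r s ξ ^ r` with `r s η ^ r`. -/
theorem isConjPair_padeForm (hr : 1 ≤ r) (H : IsPrimitiveDiagonalization r F α β γ δ χ a b c)
    (p : ℤ × ℤ) (n : ℕ) :
    IsConjPair (b ^ 2 - 4 * a * c) ((α * δ - β * γ) / χ)
      ((r : ℂ) ^ (3 * n) * ((α * δ - β * γ) / χ) ^ n *
        padeForm (r : ℝ)⁻¹ n (linForm γ δ p ^ r) (linForm α β p ^ r))
      ((r : ℂ) ^ (3 * n) * ((α * δ - β * γ) / χ) ^ n *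
        padeForm (r : ℝ)⁻¹ n (linForm α β p ^ r) (linForm γ δ p ^ r)) := by
  have h0 := exists_discr_sq_sub a b c
  have hs := H.s_sq
  have hp := H.isConjPair_pow hr p
  set s := (α * δ - β * γ) / χ
  set X := linForm α β p ^ r
  set Y := linForm γ δ p ^ r
  have e : ∀ u v : ℂ, (r : ℂ) ^ (3 * n) * s ^ n * padeForm (r : ℝ)⁻¹ n u v =
      ∑ k ∈ Finset.range (n + 1), (((r : ℝ) ^ (2 * n) * padeCoeff (r : ℝ)⁻¹ n k : ℝ) : ℂ) *
        ((r * s * u) ^ k * (r * s * v) ^ (n - k)) := by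
    intro u v
    rw [padeForm, Finset.mul_sum]
    refine Finset.sum_congr rfl fun k hk => ?_
    obtain ⟨m, rfl⟩ := Nat.exists_eq_add_of_le (Nat.lt_succ_iff.1 (Finset.mem_range.1 hk))
    rw [Nat.add_sub_cancel_left, mul_pow _ u, mul_pow _ v, mul_pow, mul_pow]
    push_cast
    ring
  rw [e, e]
  refine IsConjPair.sum _ fun k hk => ?_
  obtain ⟨z, hz⟩ := exists_int_padeCoeff (r := r) (by omega) 1
    (Nat.lt_succ_iff.1 (Finset.mem_range.1 hk))
  rw [Int.cast_one, one_div] at hz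
  rw [hz, Complex.ofReal_intCast]
  exact (IsConjPair.intCast z).mul h0 hs ((hp.symm.pow h0 hs k).mul h0 hs (hp.pow h0 hs _))

/-- The lower bound for a nonzero Padé linear form at two integral points. -/
theorem norm_det_le_padeForm (hr : 1 ≤ r) (H : IsPrimitiveDiagonalization r F α β γ δ χ a b c)
    (p q : ℤ × ℤ) (n : ℕ)
    (hne : linForm α β p * linForm γ δ q *
        padeForm (r : ℝ)⁻¹ n (linForm γ δ p ^ r) (linForm α β p ^ r) -
      linForm α β q * linForm γ δ p *
        padeForm (r : ℝ)⁻¹ n (linForm α β p ^ r) (linForm γ δ p ^ r) ≠ 0) :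
    ‖α * δ - β * γ‖ ≤ (r : ℝ) ^ (3 * n) * ‖(α * δ - β * γ) / χ‖ ^ n *
      ‖linForm α β p * linForm γ δ q *
        padeForm (r : ℝ)⁻¹ n (linForm γ δ p ^ r) (linForm α β p ^ r) -
      linForm α β q * linForm γ δ p *
        padeForm (r : ℝ)⁻¹ n (linForm α β p ^ r) (linForm γ δ p ^ r)‖ := by
  have h := (H.isConjPair_cross p q).mul (exists_discr_sq_sub a b c) H.s_sq
    (H.isConjPair_padeForm hr p n)
  have hs := H.s_ne_zero
  have hχ := H.chi_ne_zero
  have hj : ‖χ‖ * ‖(α * δ - β * γ) / χ‖ = ‖α * δ - β * γ‖ := by rw [← norm_mul, H.chi_mul_s]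
  rw [← hj]
  set s := (α * δ - β * γ) / χ
  set u := padeForm (r : ℝ)⁻¹ n (linForm γ δ p ^ r) (linForm α β p ^ r)
  set v := padeForm (r : ℝ)⁻¹ n (linForm α β p ^ r) (linForm γ δ p ^ r)
  set S := linForm α β p * linForm γ δ q * u - linForm α β q * linForm γ δ p * v with hS
  have hr0 : (r : ℂ) ≠ 0 := by exact_mod_cast (by omega)
  have e : linForm α β p * linForm γ δ q / χ * ((r : ℂ) ^ (3 * n) * s ^ n * u) -
      linForm α β q * linForm γ δ p / χ * ((r : ℂ) ^ (3 * n) * s ^ n * v) =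
      (r : ℂ) ^ (3 * n) * s ^ n * S / χ := by rw [hS]; ring
  have hne' : (r : ℂ) ^ (3 * n) * s ^ n * S / χ ≠ 0 :=
    div_ne_zero (mul_ne_zero (mul_ne_zero (pow_ne_zero _ hr0) (pow_ne_zero _ hs)) hne) hχ
  have h3 := h.norm_le_norm_sub (sub_ne_zero.1 (by rw [e]; exact hne'))
  rw [e, norm_div (_ * S) χ, le_div_iff₀ (norm_pos_iff.2 hχ), norm_mul, norm_mul, norm_pow, norm_pow,
    Complex.norm_natCast] at h3
  linarith

end IsPrimitiveDiagonalization

/-! ### The gap principle and the hypergeometric method -/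

/-- The choice of the degree of the Padé approximants, in logarithmic form. -/
theorem exists_pade_degree {r l₁ l₂ k g : ℝ} (hr : 5 ≤ r) (h1 : 0 < l₁) (h2 : (r - 1) * l₁ ≤ l₂)
    (hk : k ≤ 9 / 20 * l₁) (hg : r * g ≤ l₁ + l₂) :
    ∃ n : ℕ, 1 ≤ n ∧ ∀ m : ℕ, m = n ∨ m = n + 1 →
      g + m * (k + l₁) ≤ l₂ ∧ g + m * (k + l₁) ≤ (2 * m + 1) * l₁ := by
  -- Bounding `k + l₁` by `29 / 20 * l₁` and `r g` by `l₁ + l₂`, the second inequality for `m`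
  -- reduces to this one, as `2 - 29 / 20 = 11 / 20`. The least such `n` is taken.
  have hex : ∃ n : ℕ, 1 ≤ n ∧ l₂ ≤ (11 / 20 * r * n + r - 1) * l₁ := by
    obtain ⟨n, hn⟩ := exists_nat_ge (l₂ / l₁)
    refine ⟨n + 1, by omega, ?_⟩
    rw [div_le_iff₀ h1] at hn
    refine hn.trans (mul_le_mul_of_nonneg_right ?_ h1.le)
    push_cast
    have : (0 : ℝ) ≤ n := by positivity
    nlinarith
  classical
  obtain ⟨hn1, hn2⟩ := Nat.find_spec hex
  have hmin := fun k => Nat.find_min hex (m := k)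
  set n := Nat.find hex
  have hn0 : (1 : ℝ) ≤ n := by exact_mod_cast hn1
  -- The same bounds reduce the first inequality, in its worst case `m = n + 1`, to this. It follows
  -- from the minimality of `n` if `n ≥ 2`, and from the gap `h2` if `n = 1`; `r ≥ 5 > 49 / 10`
  -- enters in both cases.
  have hlow : l₁ * (1 + 29 / 20 * r * (n + 1)) ≤ (r - 1) * l₂ := by
    rcases Nat.lt_or_ge n 2 with h | h
    · have : n = 1 := by omega
      rw [this]
      push_cast
      have h3 : (r - 1) * ((r - 1) * l₁) ≤ (r - 1) * l₂ :=
        mul_le_mul_of_nonneg_left h2 (by linarith)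
      have h4 : 0 ≤ (r * (r - 49 / 10)) * l₁ :=
        mul_nonneg (mul_nonneg (by linarith) (by linarith)) h1.le
      linarith
    · have h3 := hmin (n - 1) (by omega)
      rw [not_and, not_le] at h3
      have h4 := h3 (by omega)
      rw [Nat.cast_sub hn1, Nat.cast_one] at h4
      have h5 : (r - 1) * ((11 / 20 * r * (n - 1) + r - 1) * l₁) ≤ (r - 1) * l₂ :=
        mul_le_mul_of_nonneg_left h4.le (by linarith)
      refine le_trans ?_ h5
      have h6 : 0 ≤ (r * (r - 49 / 10) + r * (n - 1) * (11 / 20 * (r - 1) - 29 / 20)) * l₁ := by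
        refine mul_nonneg (add_nonneg (mul_nonneg (by linarith) (by linarith)) ?_) h1.le
        exact mul_nonneg (mul_nonneg (by linarith) (by linarith)) (by linarith)
      linarith
  refine ⟨n, hn1, fun m hm => ?_⟩
  have hmn : (n : ℝ) ≤ m ∧ (m : ℝ) ≤ n + 1 := by
    rcases hm with rfl | rfl
    · exact ⟨le_rfl, by linarith⟩
    · push_cast; exact ⟨by linarith, le_rfl⟩
  have hmk : m * (k + l₁) ≤ m * (29 / 20 * l₁) :=
    mul_le_mul_of_nonneg_left (by linarith) (by positivity)
  have hr0 : 0 < r := by linarith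
  constructor
  · refine le_of_mul_le_mul_left ?_ hr0
    have : r * (m * (29 / 20 * l₁)) ≤ r * ((n + 1) * (29 / 20 * l₁)) := by
      have := hmn.2
      gcongr
    have := mul_le_mul_of_nonneg_left hmk hr0.le
    linarith
  · refine le_of_mul_le_mul_left ?_ hr0
    have h3 := mul_le_mul_of_nonneg_left hmk hr0.le
    have h4 : r * (11 / 20 * l₁) * n ≤ r * (11 / 20 * l₁) * m := by
      have := hmn.1
      gcongr
    linarith

/-- The logarithm is at most `3 / 2 * ‖x - 1‖`; dividing by `r ≥ 3` leaves half of `‖x - 1‖`, and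
`‖exp t - 1‖ ≤ 2 ‖t‖`. -/
theorem norm_cpow_inv_sub_one_le {r : ℕ} (hr : 3 ≤ r) {x : ℂ} (hx : ‖x - 1‖ ≤ 1 / 2) :
    ‖x ^ ((r : ℂ)⁻¹) - 1‖ ≤ ‖x - 1‖ := by
  have hx0 : x ≠ 0 := by
    rintro rfl
    norm_num at hx
  have hr0 : (0 : ℝ) < r := by exact_mod_cast (by omega)
  have hr3 : (3 : ℝ) ≤ r := by exact_mod_cast hr
  have h1 : ‖Complex.log x‖ ≤ 3 / 2 * ‖x - 1‖ := by
    have := Complex.norm_log_one_add_half_le_self hx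
    rwa [add_sub_cancel] at this
  have h2 : ‖Complex.log x * (r : ℂ)⁻¹‖ ≤ ‖x - 1‖ / 2 := by
    rw [norm_mul, norm_inv, Complex.norm_natCast, ← div_eq_mul_inv, div_le_iff₀ hr0]
    nlinarith [norm_nonneg (x - 1)]
  rw [Complex.cpow_def_of_ne_zero hx0]
  have h3 := Complex.norm_exp_sub_one_le (x := Complex.log x * (r : ℂ)⁻¹) (by linarith)
  linarith

/-- The `r`-th root of unity closest to `η / ξ`, when `(η / ξ) ^ r` is close to `1`. -/
noncomputable def rootClass (r : ℕ) (ξ η : ℂ) : ℂ := η / ξ / (η ^ r / ξ ^ r) ^ ((r : ℂ)⁻¹)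

theorem rootClass_pow {r : ℕ} (hr : r ≠ 0) {ξ η : ℂ} (hξ : ξ ≠ 0) (hη : η ≠ 0) :
    rootClass r ξ η ^ r = 1 := by
  rw [rootClass, div_pow, div_pow, Complex.cpow_nat_inv_pow _ hr, div_self]
  exact div_ne_zero (pow_ne_zero _ hη) (pow_ne_zero _ hξ)

theorem eq_rootClass_mul {r : ℕ} {ξ η : ℂ} (hξ : ξ ≠ 0) (hη : η ≠ 0) :
    η = rootClass r ξ η * ξ * (η ^ r / ξ ^ r) ^ ((r : ℂ)⁻¹) := by
  have : (η ^ r / ξ ^ r) ^ ((r : ℂ)⁻¹) ≠ 0 := by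
    rw [Ne, Complex.cpow_eq_zero_iff, not_and_or]
    exact Or.inl (div_ne_zero (pow_ne_zero _ hη) (pow_ne_zero _ hξ))
  rw [rootClass]
  field_simp

theorem norm_rootClass {r : ℕ} (hr : r ≠ 0) {ξ η : ℂ} (hξ : ξ ≠ 0) (hη : η ≠ 0) :
    ‖rootClass r ξ η‖ = 1 :=
  Complex.norm_eq_one_of_pow_eq_one (rootClass_pow hr hξ hη) hr

theorem norm_div_pow_sub_one_le {r : ℕ} {ξ η : ℂ} {h : ℝ} (hξ : ξ ≠ 0) (hF : ‖ξ ^ r - η ^ r‖ ≤ h) :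
    ‖η ^ r / ξ ^ r - 1‖ ≤ h / ‖ξ‖ ^ r := by
  have : η ^ r / ξ ^ r - 1 = -(ξ ^ r - η ^ r) / ξ ^ r := by
    field_simp
    ring
  rw [this, norm_div, norm_neg, norm_pow]
  gcongr

theorem ne_zero_of_norm_sub_le {r : ℕ} (hr : r ≠ 0) {ξ η : ℂ} {h : ℝ} (hξ : ξ ≠ 0)
    (hF : ‖ξ ^ r - η ^ r‖ ≤ h) (hz : h / ‖ξ‖ ^ r ≤ 1 / 2) : η ≠ 0 := by
  rintro rfl
  have := (norm_div_pow_sub_one_le hξ hF).trans hz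
  rw [zero_pow hr] at this
  norm_num at this

/-- The gap principle. -/
theorem gap_principle {r : ℕ} (hr : 3 ≤ r) {ξ₁ η₁ ξ₂ η₂ : ℂ} {h j : ℝ} (hh : 0 < h)
    (hξ₁ : ξ₁ ≠ 0) (hξ₂ : ξ₂ ≠ 0) (hF₁ : ‖ξ₁ ^ r - η₁ ^ r‖ ≤ h) (hF₂ : ‖ξ₂ ^ r - η₂ ^ r‖ ≤ h)
    (hz₁ : h / ‖ξ₁‖ ^ r ≤ 1 / 2) (hz₂ : h / ‖ξ₂‖ ^ r ≤ h / ‖ξ₁‖ ^ r)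
    (hω : rootClass r ξ₁ η₁ = rootClass r ξ₂ η₂) (hj0 : 0 ≤ j) (hj : j ≤ ‖ξ₁ * η₂ - ξ₂ * η₁‖)
    (hjh : 2 ^ r * h ^ 2 ≤ j ^ r) :
    h / ‖ξ₂‖ ^ r ≤ (h / ‖ξ₁‖ ^ r) ^ (r - 1) := by
  have hr0 : r ≠ 0 := by omega
  have hη₁ := ne_zero_of_norm_sub_le hr0 hξ₁ hF₁ hz₁
  have hη₂ := ne_zero_of_norm_sub_le hr0 hξ₂ hF₂ (hz₂.trans hz₁)
  have e₁ := eq_rootClass_mul (r := r) hξ₁ hη₁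
  have e₂ := eq_rootClass_mul (r := r) hξ₂ hη₂
  have n₁ := norm_rootClass hr0 hξ₁ hη₁
  have b₁ := norm_div_pow_sub_one_le hξ₁ hF₁
  have b₂ := norm_div_pow_sub_one_le hξ₂ hF₂
  have c₁ := norm_cpow_inv_sub_one_le hr (b₁.trans hz₁)
  have c₂ := norm_cpow_inv_sub_one_le hr (b₂.trans (hz₂.trans hz₁))
  set x₁ := (η₁ ^ r / ξ₁ ^ r) ^ ((r : ℂ)⁻¹)
  set x₂ := (η₂ ^ r / ξ₂ ^ r) ^ ((r : ℂ)⁻¹)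
  -- The common root of unity factors out, leaving a difference of two numbers within `h / ‖ξ₁‖ ^ r`
  -- of `1`.
  have e : ξ₁ * η₂ - ξ₂ * η₁ = ξ₁ * ξ₂ * rootClass r ξ₁ η₁ * ((x₂ - 1) - (x₁ - 1)) := by
    rw [← hω] at e₂
    linear_combination ξ₁ * e₂ - ξ₂ * e₁
  have h3 : j ≤ ‖ξ₁‖ * ‖ξ₂‖ * (2 * (h / ‖ξ₁‖ ^ r)) := by
    refine hj.trans ?_
    rw [e, norm_mul, norm_mul, norm_mul, n₁, mul_one]
    refine mul_le_mul_of_nonneg_left ((norm_sub_le _ _).trans ?_) (by positivity)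
    linarith
  have p₁ : 0 < ‖ξ₁‖ ^ r := pow_pos (norm_pos_iff.2 hξ₁) r
  have p₂ : 0 < ‖ξ₂‖ ^ r := pow_pos (norm_pos_iff.2 hξ₂) r
  have h4 := hjh.trans (pow_le_pow_left₀ hj0 h3 r)
  rw [mul_pow, mul_pow, mul_pow] at h4
  have h5 : h ^ 2 ≤ ‖ξ₁‖ ^ r * ‖ξ₂‖ ^ r * (h / ‖ξ₁‖ ^ r) ^ r := by
    refine le_of_mul_le_mul_left ?_ (by positivity : (0 : ℝ) < 2 ^ r)
    linarith
  obtain ⟨n, rfl⟩ := Nat.exists_eq_add_of_le' (by omega : 1 ≤ r)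
  rw [Nat.add_sub_cancel, div_le_iff₀ p₂]
  have h6 : ‖ξ₁‖ ^ (n + 1) * ‖ξ₂‖ ^ (n + 1) * (h / ‖ξ₁‖ ^ (n + 1)) ^ (n + 1) =
      h * ((h / ‖ξ₁‖ ^ (n + 1)) ^ n * ‖ξ₂‖ ^ (n + 1)) := by
    rw [pow_succ (h / _)]
    field_simp
  rw [h6, sq] at h5
  exact le_of_mul_le_mul_left h5 hh

/-- Two integral points with the same root class whose sizes are too far apart do not exist. -/
theorem hypergeometric_method {r : ℕ} {F : MvPolynomial (Fin 2) ℤ} {α β γ δ χ : ℂ} {a b c : ℤ}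
    (hr : 5 ≤ r) (H : IsPrimitiveDiagonalization r F α β γ δ χ a b c) {p q : ℤ × ℤ} {h : ℝ}
    (hh : 0 < h) (hξ₁ : linForm α β p ≠ 0) (hξ₂ : linForm α β q ≠ 0)
    (hF₁ : ‖linForm α β p ^ r - linForm γ δ p ^ r‖ ≤ h)
    (hF₁' : linForm α β p ^ r - linForm γ δ p ^ r ≠ 0)
    (hF₂ : ‖linForm α β q ^ r - linForm γ δ q ^ r‖ ≤ h)
    (hz₁ : h / ‖linForm α β p‖ ^ r < 1 / 2)
    (hω : rootClass r (linForm α β p) (linForm γ δ p) =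
      rootClass r (linForm α β q) (linForm γ δ q))
    (hjh : h ^ 2 ≤ ‖α * δ - β * γ‖ ^ r)
    (hgap : h / ‖linForm α β q‖ ^ r ≤ (h / ‖linForm α β p‖ ^ r) ^ (r - 1))
    (hK : Real.log (r ^ 8 * ‖(α * δ - β * γ) / χ‖ * h) ≤
      9 / 20 * -Real.log (h / ‖linForm α β p‖ ^ r)) : False := by
  have hr0 : r ≠ 0 := by omega
  have hrR : (5 : ℝ) ≤ r := by exact_mod_cast hr
  set ξ₁ := linForm α β p
  set η₁ := linForm γ δ p
  set ξ₂ := linForm α β q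
  set η₂ := linForm γ δ q
  have P₁ : 0 < ‖ξ₁‖ := norm_pos_iff.2 hξ₁
  have P₂ : 0 < ‖ξ₂‖ := norm_pos_iff.2 hξ₂
  set z₁ := h / ‖ξ₁‖ ^ r with hz₁d
  set z₂ := h / ‖ξ₂‖ ^ r with hz₂d
  have Z₁ : 0 < z₁ := by positivity
  have Z₂ : 0 < z₂ := by positivity
  have hz₂ : z₂ ≤ z₁ := hgap.trans (pow_le_of_le_one Z₁.le (by linarith) (by omega))
  have hη₁ := ne_zero_of_norm_sub_le hr0 hξ₁ hF₁ hz₁.le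
  have hη₂ := ne_zero_of_norm_sub_le hr0 hξ₂ hF₂ (hz₂.trans hz₁.le)
  have e₁ := eq_rootClass_mul (r := r) hξ₁ hη₁
  have e₂ := eq_rootClass_mul (r := r) hξ₂ hη₂
  have n₁ := norm_rootClass hr0 hξ₁ hη₁
  have b₁ := norm_div_pow_sub_one_le hξ₁ hF₁
  have b₂ := norm_div_pow_sub_one_le hξ₂ hF₂
  have c₂ := norm_cpow_inv_sub_one_le (by omega : 3 ≤ r) (b₂.trans (hz₂.trans hz₁.le))
  rw [← hω] at e₂
  set ω := rootClass r ξ₁ η₁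
  set x₁ := η₁ ^ r / ξ₁ ^ r with hx₁
  set x₂ := η₂ ^ r / ξ₂ ^ r
  have hx₁0 : x₁ ≠ 0 := div_ne_zero (pow_ne_zero _ hη₁) (pow_ne_zero _ hξ₁)
  have hx₁1 : x₁ ≠ 1 := by
    intro h1
    rw [hx₁, div_eq_one_iff_eq (pow_ne_zero _ hξ₁)] at h1
    exact hF₁' (by rw [h1, sub_self])
  have hω0 : ω ≠ 0 := by
    intro h0
    rw [h0, norm_zero] at n₁
    exact zero_ne_one n₁
  set ν : ℝ := (r : ℝ)⁻¹ with hν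
  have hνc : (ν : ℂ) = (r : ℂ)⁻¹ := by rw [hν]; push_cast; rfl
  have hν0 : 0 < ν := by positivity
  have hν1 : ν < 1 := inv_lt_one_of_one_lt₀ (by linarith)
  set j := ‖α * δ - β * γ‖ with hj
  have J : 0 < j := norm_pos_iff.2 H.diag.1
  set σ := ‖(α * δ - β * γ) / χ‖ with hσ
  have S : 0 < σ := norm_pos_iff.2 H.s_ne_zero
  set K := (r : ℝ) ^ 8 * σ * h with hKd
  have hK0 : 0 < K := by positivity
  have hform : ∀ n, ξ₁ * η₂ * padeForm ν n (η₁ ^ r) (ξ₁ ^ r) -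
      ξ₂ * η₁ * padeForm ν n (ξ₁ ^ r) (η₁ ^ r) = (ξ₁ ^ r) ^ n * (ξ₁ * ξ₂ * ω) *
        (x₂ ^ ((r : ℂ)⁻¹) * padeEval ν n x₁ - x₁ ^ ((r : ℂ)⁻¹) * padeEval (-ν) n x₁) := by
    intro n
    rw [padeForm_eq ν n (pow_ne_zero r hξ₁), padeForm_swap_eq ν n (pow_ne_zero r hξ₁)]
    linear_combination ξ₁ * (ξ₁ ^ r) ^ n * padeEval ν n x₁ * e₂ -
      ξ₂ * (ξ₁ ^ r) ^ n * padeEval (-ν) n x₁ * e₁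
  have hupper : ∀ n, ‖x₂ ^ ((r : ℂ)⁻¹) * padeEval ν n x₁ -
      x₁ ^ ((r : ℂ)⁻¹) * padeEval (-ν) n x₁‖ ≤ 10 * 24 ^ n * (z₂ + z₁ ^ (2 * n + 1)) := by
    intro n
    -- The first summand is controlled by the larger point `q` through `z₂`, the second is the Padé
    -- remainder at `x₁`.
    have e : x₂ ^ ((r : ℂ)⁻¹) * padeEval ν n x₁ - x₁ ^ ((r : ℂ)⁻¹) * padeEval (-ν) n x₁ =
        (x₂ ^ ((r : ℂ)⁻¹) - 1) * padeEval ν n x₁ +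
          (padeEval ν n x₁ - x₁ ^ (ν : ℂ) * padeEval (-ν) n x₁) := by rw [hνc]; ring
    have hx₁n : ‖x₁‖ ≤ 3 / 2 := by
      calc ‖x₁‖ = ‖(x₁ - 1) + 1‖ := by rw [sub_add_cancel]
        _ ≤ ‖x₁ - 1‖ + ‖(1 : ℂ)‖ := norm_add_le _ _
        _ ≤ 3 / 2 := by rw [norm_one]; linarith
    have f1 := norm_padeEval_le (ν := ν) (by rw [abs_of_pos hν0]; exact hν1.le) n hx₁n
    have f2 := norm_pade_remainder_le hν0.le hν1 n (b₁.trans_lt hz₁)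
    have f3 : 10 * 24 ^ n * ‖x₁ - 1‖ ^ (2 * n + 1) ≤ 10 * 24 ^ n * z₁ ^ (2 * n + 1) := by gcongr
    have f4 : ‖x₂ ^ ((r : ℂ)⁻¹) - 1‖ * ‖padeEval ν n x₁‖ ≤ z₂ * (10 * 24 ^ n) := by
      refine mul_le_mul (c₂.trans b₂) (f1.trans ?_) (norm_nonneg _) Z₂.le
      have : (6 : ℝ) ^ n ≤ 24 ^ n := pow_le_pow_left₀ (by norm_num) (by norm_num) n
      have : (0 : ℝ) < 24 ^ n := by positivity
      linarith
    rw [e]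
    refine (norm_add_le _ _).trans ?_
    rw [norm_mul]
    linarith
  have hmain : ∀ n, 1 ≤ n → x₂ ^ ((r : ℂ)⁻¹) * padeEval ν n x₁ -
      x₁ ^ ((r : ℂ)⁻¹) * padeEval (-ν) n x₁ ≠ 0 →
      1 ≤ 1 / 12 * (‖ξ₁‖ * ‖ξ₂‖ / j * (K / z₁) ^ n * (z₂ + z₁ ^ (2 * n + 1))) := by
    intro n hn hne
    have g1 := H.norm_det_le_padeForm (by omega) p q n (by
      rw [hform n]
      exact mul_ne_zero (mul_ne_zero (pow_ne_zero _ (pow_ne_zero _ hξ₁))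
        (mul_ne_zero (mul_ne_zero hξ₁ hξ₂) hω0)) hne)
    rw [hform n, norm_mul, norm_mul, norm_mul, norm_mul, n₁, mul_one, norm_pow, norm_pow] at g1
    have g2 : j ≤ r ^ (3 * n) * σ ^ n * ((‖ξ₁‖ ^ r) ^ n * (‖ξ₁‖ * ‖ξ₂‖) *
        (10 * 24 ^ n * (z₂ + z₁ ^ (2 * n + 1)))) := by
      refine g1.trans ?_
      have := hupper n
      gcongr
    have g3 : (‖ξ₁‖ ^ r) = h / z₁ := by rw [hz₁d]; field_simp
    -- Here `10 * 24 * 12 = 2880 ≤ 5 ^ 5`. Together with `r ^ (3 n)` this yields the factor `r ^ 8`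
    -- in `K`; any constant below `1 / 2` in place of `1 / 12` would serve the final contradiction.
    have g4 : (10 : ℝ) * 24 ^ n ≤ 1 / 12 * ((r : ℝ) ^ 5) ^ n := by
      have h5 : (5 : ℝ) ^ 5 ≤ (r : ℝ) ^ 5 := pow_le_pow_left₀ (by norm_num) hrR 5
      obtain ⟨k, rfl⟩ := Nat.exists_eq_add_of_le' hn
      have h6 : (24 : ℝ) ^ k ≤ ((r : ℝ) ^ 5) ^ k :=
        pow_le_pow_left₀ (by norm_num) (by linarith) k
      rw [pow_succ, pow_succ]
      have h7 : (24 : ℝ) ^ k * 3125 ≤ ((r : ℝ) ^ 5) ^ k * (r : ℝ) ^ 5 :=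
        mul_le_mul h6 (by linarith) (by norm_num) (by positivity)
      have h8 : (0 : ℝ) < 24 ^ k := by positivity
      linarith
    have g5 : r ^ (3 * n) * σ ^ n * ((‖ξ₁‖ ^ r) ^ n * (‖ξ₁‖ * ‖ξ₂‖) *
        (10 * 24 ^ n * (z₂ + z₁ ^ (2 * n + 1)))) ≤ r ^ (3 * n) * σ ^ n * ((h / z₁) ^ n *
        (‖ξ₁‖ * ‖ξ₂‖) * (1 / 12 * ((r : ℝ) ^ 5) ^ n * (z₂ + z₁ ^ (2 * n + 1)))) := by
      rw [g3]
      gcongr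
    have g6 : r ^ (3 * n) * σ ^ n * ((h / z₁) ^ n *
        (‖ξ₁‖ * ‖ξ₂‖) * (1 / 12 * ((r : ℝ) ^ 5) ^ n * (z₂ + z₁ ^ (2 * n + 1)))) =
        j * (1 / 12 * (‖ξ₁‖ * ‖ξ₂‖ / j * (K / z₁) ^ n * (z₂ + z₁ ^ (2 * n + 1)))) := by
      have : K / z₁ = (r : ℝ) ^ 3 * (r : ℝ) ^ 5 * σ * (h / z₁) := by rw [hKd]; ring
      rw [this, mul_pow _ (h / z₁), mul_pow _ σ, mul_pow, pow_mul]
      generalize (h / z₁) ^ n = w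
      field_simp
    have g7 := g2.trans (g5.trans_eq g6)
    exact le_of_mul_le_mul_left (by rwa [mul_one]) J
  have hlog : (r : ℝ) * Real.log (‖ξ₁‖ * ‖ξ₂‖ / j) ≤ -Real.log z₁ + -Real.log z₂ := by
    rw [← Real.log_pow, ← neg_add, ← Real.log_mul Z₁.ne' Z₂.ne', ← Real.log_inv]
    refine Real.log_le_log (by positivity) ?_
    rw [div_pow, mul_pow, div_le_iff₀ (by positivity)]
    have : (z₁ * z₂)⁻¹ = ‖ξ₁‖ ^ r * ‖ξ₂‖ ^ r / h ^ 2 := by rw [hz₁d, hz₂d]; field_simp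
    rw [this, div_mul_eq_mul_div, le_div_iff₀ (by positivity)]
    gcongr
  have hl₁ : 0 < -Real.log z₁ := neg_pos.2 (Real.log_neg Z₁ (by linarith))
  have hl₂ : ((r : ℝ) - 1) * -Real.log z₁ ≤ -Real.log z₂ := by
    have := Real.log_le_log Z₂ hgap
    rw [Real.log_pow, Nat.cast_sub (by omega), Nat.cast_one] at this
    linarith
  obtain ⟨n, hn, hnm⟩ := exists_pade_degree hrR hl₁ hl₂ hK hlog
  -- The two inequalities of `exists_pade_degree` bound the two summands by `1` each.
  have hsmall : ∀ m, m = n ∨ m = n + 1 →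
      ‖ξ₁‖ * ‖ξ₂‖ / j * (K / z₁) ^ m * (z₂ + z₁ ^ (2 * m + 1)) ≤ 2 := by
    intro m hm
    obtain ⟨k1, k2⟩ := hnm m hm
    have hlogm : Real.log (‖ξ₁‖ * ‖ξ₂‖ / j * (K / z₁) ^ m) =
        Real.log (‖ξ₁‖ * ‖ξ₂‖ / j) + m * (Real.log K + -Real.log z₁) := by
      rw [Real.log_mul (by positivity) (by positivity), Real.log_pow, Real.log_div hK0.ne' Z₁.ne']
      ring
    have u1 : ‖ξ₁‖ * ‖ξ₂‖ / j * (K / z₁) ^ m * z₂ ≤ 1 := by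
      rw [← Real.log_nonpos_iff (by positivity), Real.log_mul (by positivity) Z₂.ne', hlogm]
      linarith
    have u2 : ‖ξ₁‖ * ‖ξ₂‖ / j * (K / z₁) ^ m * z₁ ^ (2 * m + 1) ≤ 1 := by
      rw [← Real.log_nonpos_iff (by positivity), Real.log_mul (by positivity) (by positivity),
        hlogm, Real.log_pow]
      push_cast
      linarith
    linarith
  have hzero : ∀ m, m = n ∨ m = n + 1 → x₂ ^ ((r : ℂ)⁻¹) * padeEval ν m x₁ -
      x₁ ^ ((r : ℂ)⁻¹) * padeEval (-ν) m x₁ = 0 := by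
    intro m hm
    by_contra hne
    have v1 := hmain m (by omega) hne
    have v2 := hsmall m hm
    linarith
  have y1 := hzero n (Or.inl rfl)
  have y2 := hzero (n + 1) (Or.inr rfl)
  have hpow : x₁ ^ ((r : ℂ)⁻¹) ≠ 0 := by
    rw [Ne, Complex.cpow_eq_zero_iff, not_and_or]
    exact Or.inl hx₁0
  refine pade_det_ne_zero hν0 hν1 n hx₁1 (mul_left_cancel₀ hpow ?_)
  linear_combination padeEval ν (n + 1) x₁ * y1 - padeEval ν n x₁ * y2

/-! ### Numerical estimates -/

/-- The ratio between the size of large solutions and `h`. -/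
noncomputable def sizeRatio (r : ℕ) (d ε : ℝ) : ℝ := (r : ℝ) ^ 5 * d ^ ε

section Numeric

variable {r : ℕ} {j h d ε : ℝ}

theorem log_disc (hr : 5 ≤ r) (hj : 0 < j) (hd : d = (r : ℝ) ^ r * j ^ (r * (r - 1))) :
    Real.log d = r * Real.log r + r * ((r : ℝ) - 1) * Real.log j := by
  have hr0 : (0 : ℝ) < r := by exact_mod_cast (by omega)
  rw [hd, Real.log_mul (by positivity) (by positivity), Real.log_pow, Real.log_pow, Nat.cast_mul,
    Nat.cast_sub (by omega), Nat.cast_one]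

theorem log_height_le (hr : 5 ≤ r) (hj : 0 < j) (hd : d = (r : ℝ) ^ r * j ^ (r * (r - 1)))
    (hh0 : 1 ≤ h)
    (hh : h ≤ d ^ (1 / (2 * ((r : ℝ) - 1)) - ε) / ((2 : ℝ) ^ ((r : ℝ) / 2) * (r : ℝ) ^ 7)) :
    Real.log h ≤ (1 / (2 * ((r : ℝ) - 1)) - ε) * Real.log d - r / 2 * Real.log 2
      - 7 * Real.log r := by
  have hr0 : (0 : ℝ) < r := by exact_mod_cast (by omega)
  have hd0 : 0 < d := by rw [hd]; positivity
  have := Real.log_le_log (by linarith) hh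
  rw [Real.log_div (by positivity) (by positivity), Real.log_mul (by positivity) (by positivity),
    Real.log_rpow hd0, Real.log_rpow two_pos, Real.log_pow] at this
  push_cast at this
  linarith

theorem log_disc_pos (hr : 5 ≤ r) (hj : 0 < j) (hd : d = (r : ℝ) ^ r * j ^ (r * (r - 1)))
    (hh0 : 1 ≤ h) (hε' : ε < 1 / (2 * ((r : ℝ) - 1)))
    (hh : h ≤ d ^ (1 / (2 * ((r : ℝ) - 1)) - ε) / ((2 : ℝ) ^ ((r : ℝ) / 2) * (r : ℝ) ^ 7)) :
    0 < Real.log d := by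
  have hr1 : (5 : ℝ) ≤ r := by exact_mod_cast hr
  have h1 := log_height_le hr hj hd hh0 hh
  have h2 := Real.log_nonneg hh0
  have h3 : 0 < Real.log r := Real.log_pos (by linarith)
  have h4 : 0 < Real.log 2 := Real.log_pos (by norm_num)
  have h5 : 0 < (1 / (2 * ((r : ℝ) - 1)) - ε) * Real.log d := by
    have : 0 ≤ (r : ℝ) / 2 * Real.log 2 := by positivity
    linarith
  exact (pos_iff_pos_of_mul_pos h5).1 (by linarith)

theorem log_sizeRatio (hr : 5 ≤ r) (hd0 : 0 < d) :
    Real.log (sizeRatio r d ε) = 5 * Real.log r + ε * Real.log d := by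
  have hr0 : (0 : ℝ) < r := by exact_mod_cast (by omega)
  rw [sizeRatio, Real.log_mul (by positivity) (by positivity), Real.log_pow, Real.log_rpow hd0]
  push_cast
  ring

theorem sizeRatio_ge (hr : 5 ≤ r) (hε : 0 < ε) (hd1 : 1 ≤ d) : 5 ≤ sizeRatio r d ε := by
  have hr1 : (5 : ℝ) ≤ r := by exact_mod_cast hr
  have h1 : 1 ≤ d ^ ε := Real.one_le_rpow hd1 hε.le
  have h2 : (5 : ℝ) ^ 5 ≤ (r : ℝ) ^ 5 := pow_le_pow_left₀ (by norm_num) hr1 5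
  rw [sizeRatio]
  nlinarith

/-- Expanding `log d`, the exponent `1 / (2 (r - 1))` yields `(r / 2) log j` plus less than one `log
r`. The denominator `r ^ 7` pays for that, for the factor `r`, and for `r ^ 5` in `sizeRatio`; the
`-ε` pays for `d ^ ε`. -/
theorem two_pow_mul_height_lt (hr : 5 ≤ r) (hj : 0 < j)
    (hd : d = (r : ℝ) ^ r * j ^ (r * (r - 1))) (hh0 : 1 ≤ h)
    (hh : h ≤ d ^ (1 / (2 * ((r : ℝ) - 1)) - ε) / ((2 : ℝ) ^ ((r : ℝ) / 2) * (r : ℝ) ^ 7)) :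
    2 ^ r * (h * r * sizeRatio r d ε) ^ 2 < j ^ r := by
  have hr1 : (5 : ℝ) ≤ r := by exact_mod_cast hr
  have hr0 : (0 : ℝ) < r := by linarith
  have hd0 : 0 < d := by rw [hd]; positivity
  have hW : 0 < sizeRatio r d ε := by rw [sizeRatio]; positivity
  have h1 := log_height_le hr hj hd hh0 hh
  have h2 := log_disc hr hj hd
  have h3 : 0 < Real.log r := Real.log_pos (by linarith)
  rw [← Real.log_lt_log_iff (by positivity) (by positivity),
    Real.log_mul (by positivity) (by positivity), Real.log_pow, Real.log_pow, Real.log_pow,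
    Real.log_mul (by positivity) (by positivity), Real.log_mul (by positivity) (by positivity),
    log_sizeRatio hr hd0]
  have h4 : 1 / (2 * ((r : ℝ) - 1)) * Real.log d =
      r / 2 * Real.log j + r / (2 * (r - 1)) * Real.log r := by
    have : (r : ℝ) - 1 ≠ 0 := by linarith
    rw [h2]
    field_simp
    ring
  have h5 : (r : ℝ) / (2 * (r - 1)) < 1 := by
    rw [div_lt_one (by linarith)]
    linarith
  have h6 : (r : ℝ) / (2 * (r - 1)) * Real.log r < 1 * Real.log r :=
    mul_lt_mul_of_pos_right h5 h3
  push_cast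
  linarith

/-- This supplies `hK` in `hypergeometric_method`, since after `m - 2` gaps `-log z₁` is at least
`(r - 1) ^ (m - 2) log W`. It is where the condition relating `m` and `ε` is spent. -/
theorem log_height_bound (hr : 5 ≤ r) (hj : 0 < j) (hd : d = (r : ℝ) ^ r * j ^ (r * (r - 1)))
    (hh0 : 1 ≤ h) (hε : 0 < ε) (hε' : ε < 1 / (2 * ((r : ℝ) - 1)))
    (hh : h ≤ d ^ (1 / (2 * ((r : ℝ) - 1)) - ε) / ((2 : ℝ) ^ ((r : ℝ) / 2) * (r : ℝ) ^ 7))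
    {m : ℕ} (hm : 3 ≤ m)
    (hmε : ((r : ℝ) ^ 2 + r + 2) /
      (4 * ((r : ℝ) - 1) * (((r : ℝ) - 1) ^ (m - 1) - 2 * r - 1)) < ε)
    {σ : ℝ} (hσ0 : 0 < σ) (hσ : σ ^ (r - 2) ≤ (r : ℝ) ^ 2 * j ^ r) :
    Real.log ((r : ℝ) ^ 8 * σ * h) ≤
      9 / 20 * (((r - 1) ^ (m - 2) : ℕ) * Real.log (sizeRatio r d ε)) := by
  have hr1 : (5 : ℝ) ≤ r := by exact_mod_cast hr
  have hr0 : (0 : ℝ) < r := by linarith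
  have hd0 : 0 < d := by rw [hd]; positivity
  obtain ⟨k, rfl⟩ := Nat.exists_eq_add_of_le' hm
  have hT := log_disc_pos hr hj hd hh0 hε' hh
  have h1 := log_height_le hr hj hd hh0 hh
  have h2 := log_disc hr hj hd
  have h3 : 0 < Real.log r := Real.log_pos (by linarith)
  have h4 : 0 < Real.log 2 := Real.log_pos (by norm_num)
  rw [log_sizeRatio hr hd0, Real.log_mul (by positivity) (by linarith),
    Real.log_mul (by positivity) (by positivity), Real.log_pow, Nat.cast_pow,
    Nat.cast_sub (by omega), Nat.cast_one, show k + 3 - 2 = k + 1 by omega]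
  rw [show k + 3 - 1 = k + 1 + 1 by omega, pow_succ ((r : ℝ) - 1)] at hmε
  set q : ℝ := ((r : ℝ) - 1) ^ (k + 1) with hq
  have hq4 : (r : ℝ) - 1 ≤ q := by
    rw [hq, pow_succ]
    exact le_mul_of_one_le_left (by linarith) (one_le_pow₀ (by linarith))
  have hqε : (r : ℝ) ^ 2 + r + 2 < 4 * (r - 1) ^ 2 * (q * ε) := by
    have hpos : 0 < 4 * ((r : ℝ) - 1) * (q * (r - 1) - 2 * r - 1) := by
      have : ((r : ℝ) - 1) * (r - 1) ≤ q * (r - 1) :=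
        mul_le_mul_of_nonneg_right hq4 (by linarith)
      exact mul_pos (by linarith) (by nlinarith)
    rw [div_lt_iff₀ hpos] at hmε
    have : 0 < ε * (4 * ((r : ℝ) - 1) * (2 * r + 1)) :=
      mul_pos hε (mul_pos (by linarith) (by linarith))
    linarith
  have hs : ((r : ℝ) - 2) * Real.log σ ≤ 2 * Real.log r + r * Real.log j := by
    have := Real.log_le_log (by positivity) hσ
    rw [Real.log_pow, Real.log_mul (by positivity) (by positivity), Real.log_pow, Real.log_pow,
      Nat.cast_sub (by omega)] at this
    exact_mod_cast this
  have hu : 0 < (r : ℝ) - 1 := by linarith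
  have hv : 0 < (r : ℝ) - 2 := by linarith
  have hJ : r * Real.log j = (Real.log d - r * Real.log r) / (r - 1) := by
    rw [h2]; field_simp; ring
  have hs' : Real.log σ ≤ (Real.log d / (r - 1) + 2 * Real.log r) / (r - 2) := by
    rw [le_div_iff₀ hv]
    have : 0 ≤ r * Real.log r / ((r : ℝ) - 1) := by positivity
    rw [hJ, sub_div] at hs
    linarith
  -- The left side is the coefficient of `log d` in the bounds for `log σ` and `log h` together. The
  -- constant `9 / 20` is admissible by the cubic inequality `e2`, valid for `r ≥ 5`.
  have hA : (r : ℝ) / (2 * (r - 1) * (r - 2)) ≤ 9 / 20 * (q * ε) := by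
    rw [div_le_iff₀ (by positivity)]
    have e1 : 0 ≤ (r - 2) * (4 * (r - 1) ^ 2 * (q * ε) - ((r : ℝ) ^ 2 + r + 2)) :=
      mul_nonneg hv.le (by linarith)
    have e2 : 0 ≤ 9 * (((r : ℝ) ^ 2 + r + 2) * (r - 2)) - 40 * r * (r - 1) := by
      have : 0 ≤ ((r : ℝ) - 5) * (9 * r ^ 2 - 4 * r + 20) + 64 :=
        add_nonneg (mul_nonneg (by linarith) (by nlinarith)) (by norm_num)
      linarith
    refine le_of_mul_le_mul_left ?_ (by linarith : 0 < 40 * ((r : ℝ) - 1))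
    linarith
  have hB : (Real.log d / (r - 1) + 2 * Real.log r) / (r - 2) +
      1 / (2 * ((r : ℝ) - 1)) * Real.log d =
      r / (2 * (r - 1) * (r - 2)) * Real.log d + 2 * Real.log r / (r - 2) := by
    field_simp
    ring
  have hC : 2 * Real.log r / ((r : ℝ) - 2) ≤ Real.log r := by
    rw [div_le_iff₀ hv]
    have : Real.log r * 2 ≤ Real.log r * (r - 2) := mul_le_mul_of_nonneg_left (by linarith) h3.le
    linarith
  have hE := mul_le_mul_of_nonneg_right hA hT.le
  have hG : 0 < ε * Real.log d := mul_pos hε hT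
  have hI : 4 * Real.log r ≤ q * Real.log r := mul_le_mul_of_nonneg_right (by linarith) h3.le
  have hM : 0 ≤ (r : ℝ) / 2 * Real.log 2 := by positivity
  push_cast
  linarith

end Numeric

/-! ### Chains of large solutions -/

/-- Induction by removing a minimizer: each further point multiplies the exponent by `e`. -/
theorem exists_min_le_pow {ι : Type*} [DecidableEq ι] {z : ι → ℝ} {w : ℝ} (e : ℕ) (T : Finset ι)
    (hT : T.Nonempty) (hz : ∀ p ∈ T, 0 ≤ z p) (hw : ∀ p ∈ T, z p ≤ w)
    (hgap : ∀ p ∈ T, ∀ q ∈ T, p ≠ q → z q ≤ z p → z q ≤ z p ^ e) :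
    ∃ q ∈ T, (∀ p ∈ T, z q ≤ z p) ∧ z q ≤ w ^ (e ^ (T.card - 1)) := by
  induction hk : T.card using Nat.strong_induction_on generalizing T with
  | _ k ih =>
    obtain ⟨q, hq, hmin⟩ := T.exists_min_image z hT
    refine ⟨q, hq, hmin, ?_⟩
    have hcard := Finset.card_erase_of_mem hq
    rcases (T.erase q).eq_empty_or_nonempty with h0 | hne
    · rw [h0, Finset.card_empty] at hcard
      rw [show k - 1 = 0 by omega]
      simpa using hw q hq
    · have hpos := hne.card_pos
      have hsub := Finset.erase_subset q T
      obtain ⟨p, hp, -, hpw⟩ := ih (T.erase q).card (by omega) (T.erase q) hne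
        (fun p hp => hz p (hsub hp)) (fun p hp => hw p (hsub hp))
        (fun p hp p' hp' => hgap p (hsub hp) p' (hsub hp')) rfl
      refine (hgap p (hsub hp) q hq (Finset.ne_of_mem_erase hp) (hmin p (hsub hp))).trans ?_
      refine (pow_le_pow_left₀ (hz p (hsub hp)) hpw e).trans_eq ?_
      rw [← pow_mul, ← pow_succ, hcard, hk]
      congr 2
      omega

/-- The pair consists of a minimizer `q` and a minimizer `p` of what remains; `p` lies below `card -
2` gaps. -/
theorem exists_pair_le_pow {ι : Type*} {z : ι → ℝ} {w : ℝ} (e : ℕ) (T : Finset ι)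
    (hT : 2 ≤ T.card) (hz : ∀ p ∈ T, 0 ≤ z p) (hw : ∀ p ∈ T, z p ≤ w)
    (hgap : ∀ p ∈ T, ∀ q ∈ T, p ≠ q → z q ≤ z p → z q ≤ z p ^ e) :
    ∃ p ∈ T, ∃ q ∈ T, p ≠ q ∧ z q ≤ z p ∧ z p ≤ w ^ (e ^ (T.card - 2)) := by
  classical
  obtain ⟨q, hq, hmin⟩ := T.exists_min_image z (Finset.card_pos.1 (by omega))
  have hcard := Finset.card_erase_of_mem hq
  have hsub := Finset.erase_subset q T
  obtain ⟨p, hp, -, hpw⟩ := exists_min_le_pow e (T.erase q) (Finset.card_pos.1 (by omega))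
    (fun p hp => hz p (hsub hp)) (fun p hp => hw p (hsub hp))
    (fun p hp p' hp' => hgap p (hsub hp) p' (hsub hp'))
  refine ⟨p, hsub hp, q, hq, Finset.ne_of_mem_erase hp, hmin p (hsub hp), ?_⟩
  rwa [hcard, Nat.sub_sub] at hpw

/-! ### Counting solutions -/

/-- The primitive solutions with a normalized sign. -/
def normalizedSolutions (F : MvPolynomial (Fin 2) ℤ) (h : ℤ) : Set (ℤ × ℤ) :=
  {p | p ∈ primitiveSolutions F h ∧ (0 < p.1 ∨ p.1 = 0 ∧ 0 < p.2)}

theorem eval_neg_of_diag {r : ℕ} {F : MvPolynomial (Fin 2) ℤ} {α β γ δ : ℂ}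
    (hF : IsDiagonalization r F α β γ δ) (p : ℤ × ℤ) :
    |eval ![(-p).1, (-p).2] F| = |eval ![p.1, p.2] F| := by
  have h1 := hF.eval_eq p
  have h2 := hF.eval_eq (-p)
  have e : ∀ a b : ℂ, linForm a b (-p) = -linForm a b p := fun a b => by
    simp only [linForm, Prod.fst_neg, Prod.snd_neg]; push_cast; ring
  rw [e, e] at h2
  rcases Nat.even_or_odd r with hr | hr
  · rw [hr.neg_pow, hr.neg_pow, ← h1] at h2
    rw [Int.cast_injective h2]
  · rw [hr.neg_pow, hr.neg_pow] at h2
    have h3 : ((eval ![(-p).1, (-p).2] F : ℤ) : ℂ) = ((-eval ![p.1, p.2] F : ℤ) : ℂ) := by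
      rw [h2]; push_cast; rw [h1]; ring
    rw [Int.cast_injective h3, abs_neg]

theorem numPrimitiveSolutions_le {r : ℕ} {F : MvPolynomial (Fin 2) ℤ} {α β γ δ : ℂ}
    (hF : IsDiagonalization r F α β γ δ) (h : ℤ) :
    numPrimitiveSolutions F h ≤ (normalizedSolutions F h).encard := by
  refine (Set.encard_le_encard ?_).trans
    (Set.encard_image_le (fun p : ℤ × ℤ => ({p, -p} : Set (ℤ × ℤ))) (normalizedSolutions F h))
  rintro _ ⟨p, hp, rfl⟩
  have hneg : -p ∈ primitiveSolutions F h := by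
    obtain ⟨h1, h2, h3⟩ := hp
    refine ⟨by simpa using h1, ?_, ?_⟩ <;> rw [eval_neg_of_diag hF] <;> assumption
  have hp0 : p.1 ≠ 0 ∨ p.2 ≠ 0 := by
    by_contra! h0
    have := hp.1
    rw [h0.1, h0.2] at this
    simp at this
  by_cases hs : 0 < p.1 ∨ p.1 = 0 ∧ 0 < p.2
  · exact ⟨p, ⟨hp, hs⟩, rfl⟩
  · refine ⟨-p, ⟨hneg, ?_⟩, ?_⟩
    · rw [Prod.fst_neg, Prod.snd_neg]
      omega
    · simp only [neg_neg]
      exact Set.pair_comm _ _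

/-- Proportional primitive vectors agree up to sign, and the normalization fixes the sign. -/
theorem det_ne_zero_of_normalized {F : MvPolynomial (Fin 2) ℤ} {h : ℤ} {p q : ℤ × ℤ}
    (hp : p ∈ normalizedSolutions F h) (hq : q ∈ normalizedSolutions F h) (hne : p ≠ q) :
    p.1 * q.2 - q.1 * p.2 ≠ 0 := by
  intro h0
  apply hne
  obtain ⟨⟨gp, -, -⟩, sp⟩ := hp
  obtain ⟨⟨gq, -, -⟩, sq⟩ := hq
  obtain ⟨x, y⟩ := p
  obtain ⟨u, v⟩ := q
  simp only at *
  have cp : IsCoprime x y := Int.isCoprime_iff_gcd_eq_one.2 gp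
  have cq : IsCoprime u v := Int.isCoprime_iff_gcd_eq_one.2 gq
  have h1 : x * v = u * y := by linarith
  have d1 : x ∣ u := cp.dvd_of_dvd_mul_right (h1 ▸ dvd_mul_right x v)
  have d2 : u ∣ x := cq.dvd_of_dvd_mul_right (h1 ▸ dvd_mul_right u y)
  have d3 : y ∣ v := cp.symm.dvd_of_dvd_mul_left (h1 ▸ dvd_mul_left y u)
  have d4 : v ∣ y := cq.symm.dvd_of_dvd_mul_left (h1 ▸ dvd_mul_left v x)
  have a1 := Int.natAbs_eq_of_dvd_dvd d1 d2
  have a2 := Int.natAbs_eq_of_dvd_dvd d3 d4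
  have hxu : x = u := by omega
  rw [Prod.mk.injEq]
  refine ⟨hxu, ?_⟩
  subst hxu
  rcases eq_or_ne x 0 with rfl | hx
  · omega
  · exact (mul_left_cancel₀ hx h1).symm

theorem linForm_cross (α β γ δ : ℂ) (p q : ℤ × ℤ) :
    linForm α β p * linForm γ δ q - linForm α β q * linForm γ δ p =
      (α * δ - β * γ) * ((p.1 * q.2 - q.1 * p.2 : ℤ) : ℂ) := by
  simp only [linForm]
  push_cast
  ring

theorem norm_det_le_norm_cross {F : MvPolynomial (Fin 2) ℤ} {h : ℤ} (α β γ δ : ℂ) {p q : ℤ × ℤ}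
    (hp : p ∈ normalizedSolutions F h) (hq : q ∈ normalizedSolutions F h) (hne : p ≠ q) :
    ‖α * δ - β * γ‖ ≤ ‖linForm α β p * linForm γ δ q - linForm α β q * linForm γ δ p‖ := by
  rw [linForm_cross, norm_mul, Complex.norm_intCast]
  refine le_mul_of_one_le_right (norm_nonneg _) ?_
  exact_mod_cast Int.one_le_abs (det_ne_zero_of_normalized hp hq hne)

theorem IsDiagonalization.norm_sub_le {r : ℕ} {F : MvPolynomial (Fin 2) ℤ} {α β γ δ : ℂ} {h : ℤ}
    (hF : IsDiagonalization r F α β γ δ) {p : ℤ × ℤ} (hp : p ∈ normalizedSolutions F h) :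
    ‖linForm α β p ^ r - linForm γ δ p ^ r‖ ≤ h ∧ linForm α β p ^ r - linForm γ δ p ^ r ≠ 0 := by
  obtain ⟨⟨-, h1, h2⟩, -⟩ := hp
  rw [← hF.eval_eq, Complex.norm_intCast]
  exact ⟨by exact_mod_cast h2, by exact_mod_cast abs_pos.1 h1⟩

/-- Since `|η| ^ r ≤ |ξ| ^ r + h`, all four linear forms have `r`-th power at most `h r W`. Two
distinct points would then have a cross determinant smaller than `|j|`. -/
theorem eq_of_small {r : ℕ} {F : MvPolynomial (Fin 2) ℤ} {α β γ δ : ℂ} {h : ℤ} {W : ℝ}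
    (hr : 5 ≤ r) (hF : IsDiagonalization r F α β γ δ) (hh : 0 < h) (hW : 1 ≤ W)
    (hjh : 2 ^ r * ((h : ℝ) * r * W) ^ 2 < ‖α * δ - β * γ‖ ^ r) {p q : ℤ × ℤ}
    (hp : p ∈ normalizedSolutions F h) (hq : q ∈ normalizedSolutions F h)
    (hpW : ‖linForm α β p‖ ^ r < h * W) (hqW : ‖linForm α β q‖ ^ r < h * W) : p = q := by
  by_contra hne
  have hj := norm_det_le_norm_cross α β γ δ hp hq hne
  have hr1 : (5 : ℝ) ≤ r := by exact_mod_cast hr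
  have hh1 : (1 : ℝ) ≤ h := by exact_mod_cast hh
  have hη : ∀ v ∈ normalizedSolutions F h, ‖linForm α β v‖ ^ r < h * W →
      ‖linForm γ δ v‖ ^ r ≤ h * r * W := by
    intro v hv hvW
    have h1 := (hF.norm_sub_le hv).1
    have h2 : ‖linForm γ δ v ^ r‖ ≤ ‖linForm α β v ^ r‖ +
        ‖linForm α β v ^ r - linForm γ δ v ^ r‖ := by
      have := norm_sub_le (linForm α β v ^ r) (linForm α β v ^ r - linForm γ δ v ^ r)
      rwa [sub_sub_cancel] at this
    rw [norm_pow, norm_pow] at h2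
    have h3 : (h : ℝ) * 1 ≤ h * W := mul_le_mul_of_nonneg_left hW (by linarith)
    have h4 : (h : ℝ) * W * 5 ≤ h * W * r := mul_le_mul_of_nonneg_left hr1 (by nlinarith)
    nlinarith
  have hξ : ∀ x : ℝ, x < h * W → x ≤ h * r * W := by
    intro x hx
    have h4 : (h : ℝ) * W * 5 ≤ h * W * r := mul_le_mul_of_nonneg_left hr1 (by nlinarith)
    nlinarith
  have hprod : ∀ u v : ℂ, ‖u‖ ^ r ≤ h * r * W → ‖v‖ ^ r ≤ h * r * W →
      (‖u‖ * ‖v‖) ^ r ≤ (h * r * W) ^ 2 := by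
    intro u v hu hv
    rw [mul_pow, sq]
    exact mul_le_mul hu hv (by positivity) (by positivity)
  have k1 := hprod _ _ (hξ _ hpW) (hη q hq hqW)
  have k2 := hprod _ _ (hξ _ hqW) (hη p hp hpW)
  have h5 : ‖linForm α β p * linForm γ δ q - linForm α β q * linForm γ δ p‖ ≤
      ‖linForm α β p‖ * ‖linForm γ δ q‖ + ‖linForm α β q‖ * ‖linForm γ δ p‖ := by
    refine (norm_sub_le _ _).trans ?_
    rw [norm_mul, norm_mul]
  obtain ⟨M, hM, hM0, hM1, hM2⟩ : ∃ M : ℝ, M ^ r ≤ (h * r * W) ^ 2 ∧ 0 ≤ M ∧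
      ‖linForm α β p‖ * ‖linForm γ δ q‖ ≤ M ∧ ‖linForm α β q‖ * ‖linForm γ δ p‖ ≤ M := by
    rcases le_total (‖linForm α β p‖ * ‖linForm γ δ q‖) (‖linForm α β q‖ * ‖linForm γ δ p‖)
      with h6 | h6
    · exact ⟨_, k2, by positivity, h6, le_rfl⟩
    · exact ⟨_, k1, by positivity, le_rfl, h6⟩
  have h7 : ‖α * δ - β * γ‖ ^ r ≤ (2 * M) ^ r := pow_le_pow_left₀ (norm_nonneg _) (by linarith) r
  rw [mul_pow] at h7
  have h8 : (2 : ℝ) ^ r * M ^ r ≤ 2 ^ r * (h * r * W) ^ 2 :=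
    mul_le_mul_of_nonneg_left hM (by positivity)
  linarith

/-- From `m` points of one class, iterated gaps make the second smallest `z` at most `W ^ (-(r - 1)
^ (m - 2))`, and `hypergeometric_method` applies to the two points with smallest `z`. -/
theorem card_rootClass_lt {r : ℕ} {F : MvPolynomial (Fin 2) ℤ} {α β γ δ χ : ℂ} {a b c h : ℤ}
    {W : ℝ} (hr : 5 ≤ r) (H : IsPrimitiveDiagonalization r F α β γ δ χ a b c) (hh : 0 < h)
    (hW : 5 ≤ W) (hjh : 2 ^ r * ((h : ℝ) * r * W) ^ 2 < ‖α * δ - β * γ‖ ^ r) {m : ℕ} (hm : 3 ≤ m)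
    (hK : Real.log ((r : ℝ) ^ 8 * ‖(α * δ - β * γ) / χ‖ * h) ≤
      9 / 20 * (((r - 1) ^ (m - 2) : ℕ) * Real.log W)) {ω : ℂ} {T : Finset (ℤ × ℤ)}
    (hT : ∀ p ∈ T, p ∈ normalizedSolutions F h ∧ h * W ≤ ‖linForm α β p‖ ^ r ∧
      rootClass r (linForm α β p) (linForm γ δ p) = ω) : T.card < m := by
  by_contra! hcard
  obtain ⟨T', hsub, hcard'⟩ := Finset.exists_subset_card_eq hcard
  replace hT := fun p hp => hT p (hsub hp)
  have hh0 : (0 : ℝ) < h := by exact_mod_cast hh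
  have hr1 : (5 : ℝ) ≤ r := by exact_mod_cast hr
  have hpos : ∀ p ∈ T', 0 < ‖linForm α β p‖ ^ r := fun p hp =>
    (mul_pos hh0 (by linarith)).trans_le (hT p hp).2.1
  have hne : ∀ p ∈ T', linForm α β p ≠ 0 := by
    intro p hp h0
    have := hpos p hp
    rw [h0, norm_zero, zero_pow (by omega)] at this
    exact this.false
  have hzW : ∀ p ∈ T', (h : ℝ) / ‖linForm α β p‖ ^ r ≤ W⁻¹ := by
    intro p hp
    rw [div_le_iff₀ (hpos p hp), inv_mul_eq_div, le_div_iff₀ (by linarith)]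
    exact (hT p hp).2.1
  have hW5 : W⁻¹ ≤ 5⁻¹ := inv_anti₀ (by norm_num) hW
  have hjh1 : 2 ^ r * (h : ℝ) ^ 2 ≤ ‖α * δ - β * γ‖ ^ r := by
    refine le_trans (mul_le_mul_of_nonneg_left ?_ (by positivity)) hjh.le
    refine pow_le_pow_left₀ hh0.le ?_ 2
    rw [mul_assoc]
    exact le_mul_of_one_le_right hh0.le (by nlinarith)
  have hgap : ∀ p ∈ T', ∀ q ∈ T', p ≠ q →
      (h : ℝ) / ‖linForm α β q‖ ^ r ≤ h / ‖linForm α β p‖ ^ r →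
      (h : ℝ) / ‖linForm α β q‖ ^ r ≤ (h / ‖linForm α β p‖ ^ r) ^ (r - 1) := by
    intro p hp q hq hpq hle
    exact gap_principle (by omega) hh0 (hne p hp) (hne q hq)
      (H.diag.norm_sub_le (hT p hp).1).1 (H.diag.norm_sub_le (hT q hq).1).1
      ((hzW p hp).trans (hW5.trans (by norm_num))) hle
      ((hT p hp).2.2.trans (hT q hq).2.2.symm) (norm_nonneg _)
      (norm_det_le_norm_cross α β γ δ (hT p hp).1 (hT q hq).1 hpq) hjh1
  obtain ⟨p, hp, q, hq, hpq, hle, hpw⟩ := exists_pair_le_pow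
    (z := fun p => (h : ℝ) / ‖linForm α β p‖ ^ r) (r - 1) T' (by omega)
    (fun p hp => div_nonneg hh0.le (hpos p hp).le) hzW hgap
  rw [hcard'] at hpw
  refine hypergeometric_method hr H hh0 (hne p hp) (hne q hq)
    (H.diag.norm_sub_le (hT p hp).1).1 (H.diag.norm_sub_le (hT p hp).1).2
    (H.diag.norm_sub_le (hT q hq).1).1 ((hzW p hp).trans_lt (hW5.trans_lt (by norm_num)))
    ((hT p hp).2.2.trans (hT q hq).2.2.symm) ?_ (hgap p hp q hq hpq hle) (hK.trans ?_)
  · refine le_trans ?_ hjh1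
    exact le_mul_of_one_le_left (by positivity) (one_le_pow₀ (by norm_num))
  · have := Real.log_le_log (div_pos hh0 (hpos p hp)) hpw
    rw [Real.log_pow, Real.log_inv] at this
    linarith

/-- The number of solutions in terms of the number of root classes. -/
theorem encard_normalizedSolutions_le {r : ℕ} {F : MvPolynomial (Fin 2) ℤ} {α β γ δ χ : ℂ}
    {a b c h : ℤ} {W : ℝ} (hr : 5 ≤ r) (H : IsPrimitiveDiagonalization r F α β γ δ χ a b c)
    (hh : 0 < h) (hW : 5 ≤ W) (hjh : 2 ^ r * ((h : ℝ) * r * W) ^ 2 < ‖α * δ - β * γ‖ ^ r) {m : ℕ}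
    (hm : 3 ≤ m) (hK : Real.log ((r : ℝ) ^ 8 * ‖(α * δ - β * γ) / χ‖ * h) ≤
      9 / 20 * (((r - 1) ^ (m - 2) : ℕ) * Real.log W)) (Ω : Finset ℂ)
    (hΩ : ∀ p ∈ normalizedSolutions F h, h * W ≤ ‖linForm α β p‖ ^ r →
      rootClass r (linForm α β p) (linForm γ δ p) ∈ Ω) :
    (normalizedSolutions F h).encard ≤ ((1 + Ω.card * (m - 1) : ℕ) : ℕ∞) := by
  by_contra! hlt
  -- Finiteness is not known beforehand, so the count is made in a subset with exactly one element
  -- too many.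
  have hle : ((1 + Ω.card * (m - 1) + 1 : ℕ) : ℕ∞) ≤ (normalizedSolutions F h).encard := by
    push_cast at hlt ⊢
    exact Order.add_one_le_of_lt hlt
  obtain ⟨t, ht, htc⟩ := Set.exists_subset_encard_eq hle
  have hfin : t.Finite := Set.finite_of_encard_eq_coe htc
  obtain ⟨T, rfl⟩ := hfin.exists_finset_coe
  rw [Set.encard_coe_eq_coe_finsetCard, Nat.cast_inj] at htc
  classical
  have hsmall : (T.filter fun p => ¬ h * W ≤ ‖linForm α β p‖ ^ r).card ≤ 1 := by
    rw [Finset.card_le_one]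
    intro p hp q hq
    rw [Finset.mem_filter, not_le] at hp hq
    exact eq_of_small hr H.diag hh (by linarith) hjh (ht hp.1) (ht hq.1) hp.2 hq.2
  have hlarge : (T.filter fun p => h * W ≤ ‖linForm α β p‖ ^ r).card ≤ (m - 1) * Ω.card := by
    refine Finset.card_le_mul_card_image_of_maps_to
      (f := fun p => rootClass r (linForm α β p) (linForm γ δ p)) (fun p hp => ?_) (m - 1)
      (fun ω hω => ?_)
    · rw [Finset.mem_filter] at hp
      exact hΩ p (ht hp.1) hp.2
    · have := card_rootClass_lt hr H hh hW hjh hm hK (ω := ω)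
        (T := (T.filter fun p => h * W ≤ ‖linForm α β p‖ ^ r).filter
          fun p => rootClass r (linForm α β p) (linForm γ δ p) = ω) (fun p hp => by
          rw [Finset.mem_filter, Finset.mem_filter] at hp
          exact ⟨ht hp.1.1, hp.1.2, hp.2⟩)
      omega
  have := Finset.card_filter_add_card_filter_not (s := T)
    (fun p => h * W ≤ ‖linForm α β p‖ ^ r)
  rw [mul_comm (m - 1)] at hlarge
  omega

/-! ### Positive quadratic discriminant -/

section Real

variable {r : ℕ} {F : MvPolynomial (Fin 2) ℤ} {α β γ δ χ : ℂ} {a b c : ℤ}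

theorem IsConjPair.exists_real {D : ℤ} {s u u' : ℂ} (hs : ∃ x : ℝ, s = x)
    (h : IsConjPair D s u u') : ∃ x y : ℝ, u = x ∧ u' = y := by
  obtain ⟨x, rfl⟩ := hs
  obtain ⟨p, q, rfl, rfl⟩ := h
  exact ⟨p + q * ((D + x) / 2), p + q * ((D - x) / 2), by push_cast; rfl, by push_cast; rfl⟩

theorem IsPrimitiveDiagonalization.s_real (H : IsPrimitiveDiagonalization r F α β γ δ χ a b c)
    (hD : 0 < b ^ 2 - 4 * a * c) : ∃ x : ℝ, (α * δ - β * γ) / χ = x := by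
  have h1 := H.s_sq
  have h2 : (((b ^ 2 - 4 * a * c : ℤ) : ℝ) : ℂ) =
      ((Real.sqrt ((b ^ 2 - 4 * a * c : ℤ) : ℝ) : ℝ) : ℂ) ^ 2 := by
    rw [← Complex.ofReal_pow, Real.sq_sqrt (by exact_mod_cast hD.le)]
  rw [← Complex.ofReal_intCast, h2, sq_eq_sq_iff_eq_or_eq_neg] at h1
  rcases h1 with h1 | h1
  · exact ⟨_, h1⟩
  · exact ⟨-Real.sqrt ((b ^ 2 - 4 * a * c : ℤ) : ℝ), by rw [h1]; push_cast; rfl⟩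

/-- The ratio of the `r`-th powers is a ratio of conjugates, both real since `s` is; being within `1
/ 2` of `1`, it is positive, and so its principal root is a positive real. -/
theorem IsPrimitiveDiagonalization.exists_real_root (hr : 3 ≤ r)
    (H : IsPrimitiveDiagonalization r F α β γ δ χ a b c)
    (hD : 0 < b ^ 2 - 4 * a * c) {p : ℤ × ℤ}
    (hx : ‖linForm γ δ p ^ r / linForm α β p ^ r - 1‖ ≤ 1 / 2) :
    ∃ ρ : ℝ, 0 < ρ ∧ (linForm γ δ p ^ r / linForm α β p ^ r) ^ ((r : ℂ)⁻¹) = ρ := by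
  obtain ⟨u, v, hu, hv⟩ := (H.isConjPair_pow (by omega) p).exists_real (H.s_real hD)
  have hc : (r : ℂ) * ((α * δ - β * γ) / χ) ≠ 0 :=
    mul_ne_zero (by exact_mod_cast (by omega)) H.s_ne_zero
  have e : linForm γ δ p ^ r / linForm α β p ^ r = ((v / u : ℝ) : ℂ) := by
    rw [Complex.ofReal_div, ← hu, ← hv, mul_div_mul_left _ _ hc]
  rw [e] at hx ⊢
  have hpos : 0 < v / u := by
    rw [← Complex.ofReal_one, ← Complex.ofReal_sub, Complex.norm_real, Real.norm_eq_abs,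
      abs_le] at hx
    linarith
  refine ⟨(v / u) ^ ((r : ℝ)⁻¹), Real.rpow_pos_of_pos hpos _, ?_⟩
  rw [Complex.ofReal_cpow hpos.le]
  push_cast
  rfl

/-- The quotient of the two classes is built from the real conjugate pair of `isConjPair_cross` and
two positive real roots. It is thus a real `r`-th root of unity. -/
theorem IsPrimitiveDiagonalization.rootClass_eq_or_eq_neg (hr : 3 ≤ r)
    (H : IsPrimitiveDiagonalization r F α β γ δ χ a b c)
    (hD : 0 < b ^ 2 - 4 * a * c) {p q : ℤ × ℤ} (hξp : linForm α β p ≠ 0)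
    (hηp : linForm γ δ p ≠ 0) (hξq : linForm α β q ≠ 0) (hηq : linForm γ δ q ≠ 0)
    (hxp : ‖linForm γ δ p ^ r / linForm α β p ^ r - 1‖ ≤ 1 / 2)
    (hxq : ‖linForm γ δ q ^ r / linForm α β q ^ r - 1‖ ≤ 1 / 2) :
    rootClass r (linForm α β q) (linForm γ δ q) = rootClass r (linForm α β p) (linForm γ δ p) ∨
    (Even r ∧ rootClass r (linForm α β q) (linForm γ δ q) =
      -rootClass r (linForm α β p) (linForm γ δ p)) := by
  obtain ⟨ρ, hρ, eρ⟩ := H.exists_real_root hr hD hxp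
  obtain ⟨τ, hτ, eτ⟩ := H.exists_real_root hr hD hxq
  obtain ⟨u, v, hu, hv⟩ := (H.isConjPair_cross p q).exists_real (H.s_real hD)
  have hχ := H.chi_ne_zero
  have hωp := rootClass_pow (r := r) (by omega) hξp hηp
  have hωq := rootClass_pow (r := r) (by omega) hξq hηq
  have hρc : (ρ : ℂ) ≠ 0 := by exact_mod_cast hρ.ne'
  have hτc : (τ : ℂ) ≠ 0 := by exact_mod_cast hτ.ne'
  have hv0 : (v : ℂ) ≠ 0 := hv ▸ div_ne_zero (mul_ne_zero hξq hηp) hχ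
  have key : rootClass r (linForm α β q) (linForm γ δ q) =
      ((u / v * (ρ / τ) : ℝ) : ℂ) * rootClass r (linForm α β p) (linForm γ δ p) := by
    rw [rootClass, rootClass, eρ, eτ]
    push_cast
    rw [← hu, ← hv]
    field_simp
  set x : ℝ := u / v * (ρ / τ)
  have hx : x ^ r = 1 := by
    rw [key, mul_pow, hωp, mul_one] at hωq
    exact_mod_cast hωq
  rw [key]
  rcases (pow_eq_one_iff_cases).1 hx with h | h | ⟨h, hev⟩
  · omega
  · left; rw [h]; simp
  · right; rw [h]; exact ⟨hev, by simp⟩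

/-- With `ρ` the real root of `η(p) ^ r / ξ(p) ^ r`, the equation `ρ ξ(p) η(v) = η(p) ξ(v)` becomes
real after division by `χ`. A nonzero solution `v` has `η(v) ^ r = ξ(v) ^ r`. -/
theorem IsPrimitiveDiagonalization.exists_real_zero (hr : 3 ≤ r)
    (H : IsPrimitiveDiagonalization r F α β γ δ χ a b c)
    (hD : 0 < b ^ 2 - 4 * a * c) {p : ℤ × ℤ} (hξ : linForm α β p ≠ 0)
    (hη : linForm γ δ p ≠ 0)
    (hx : ‖linForm γ δ p ^ r / linForm α β p ^ r - 1‖ ≤ 1 / 2) :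
    ∃ v : Fin 2 → ℝ, v ≠ 0 ∧ aeval v F = 0 := by
  obtain ⟨ρ, hρ, eρ⟩ := H.exists_real_root hr hD hx
  obtain ⟨a₁, b₁, ha₁, hb₁⟩ := (H.isConjPair_cross p (1, 0)).exists_real (H.s_real hD)
  obtain ⟨a₂, b₂, ha₂, hb₂⟩ := (H.isConjPair_cross p (0, 1)).exists_real (H.s_real hD)
  have hχ := H.chi_ne_zero
  rw [div_eq_iff hχ] at ha₁ hb₁ ha₂ hb₂
  simp only [linForm, Int.cast_one, Int.cast_zero, mul_one, mul_zero, add_zero, zero_add]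
    at ha₁ hb₁ ha₂ hb₂
  have hv : ∃ v : Fin 2 → ℝ, v ≠ 0 ∧ (ρ * a₁ - b₁) * v 0 + (ρ * a₂ - b₂) * v 1 = 0 := by
    by_cases h0 : ρ * a₁ - b₁ = 0
    · refine ⟨![1, 0], fun h => ?_, by simp [h0]⟩
      simpa using congrFun h 0
    · refine ⟨![ρ * a₂ - b₂, -(ρ * a₁ - b₁)], fun h => ?_, by simp; ring⟩
      have h1 : -(ρ * a₁ - b₁) = 0 := by simpa using congrFun h 1
      exact h0 (neg_eq_zero.1 h1)
  obtain ⟨v, hv0, hv⟩ := hv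
  refine ⟨v, hv0, ?_⟩
  have hvc : ((ρ : ℂ) * a₁ - b₁) * v 0 + (ρ * a₂ - b₂) * v 1 = 0 := by exact_mod_cast hv
  have hlin : ρ * linForm α β p * (γ * v 0 + δ * v 1) =
      linForm γ δ p * (α * v 0 + β * v 1) := by
    rw [linForm, linForm]
    linear_combination χ * hvc + ρ * (v 0 : ℂ) * ha₁ + ρ * (v 1 : ℂ) * ha₂ -
      (v 0 : ℂ) * hb₁ - (v 1 : ℂ) * hb₂
  have hρr : (ρ : ℂ) ^ r = linForm γ δ p ^ r / linForm α β p ^ r := by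
    rw [← eρ, Complex.cpow_nat_inv_pow _ (by omega)]
  have hpow := congrArg (· ^ r) hlin
  simp only [mul_pow, hρr] at hpow
  rw [div_mul_cancel₀ _ (pow_ne_zero r hξ)] at hpow
  have heq := mul_left_cancel₀ (pow_ne_zero r hη) hpow
  have hF := aeval_ofReal F v
  rw [H.diag.2] at hF
  simp only [map_sub, map_pow, map_add, map_mul, eval_C, eval_X, Matrix.cons_val_zero,
    Matrix.cons_val_one] at hF
  rw [heq, sub_self] at hF
  exact_mod_cast hF

end Real

/-! ### Assembly of the bounds. -/

/-- Large solutions have nonzero linear forms whose `r`-th powers have a ratio close to `1`. -/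
theorem IsDiagonalization.large_solution {r : ℕ} {F : MvPolynomial (Fin 2) ℤ} {α β γ δ : ℂ} {h : ℤ}
    {W : ℝ} (hr : r ≠ 0) (hF : IsDiagonalization r F α β γ δ) (hh : 0 < h) (hW : 5 ≤ W)
    {p : ℤ × ℤ} (hp : p ∈ normalizedSolutions F h) (hpW : h * W ≤ ‖linForm α β p‖ ^ r) :
    linForm α β p ≠ 0 ∧ linForm γ δ p ≠ 0 ∧
      ‖linForm γ δ p ^ r / linForm α β p ^ r - 1‖ ≤ 1 / 2 := by
  have hh0 : (0 : ℝ) < h := by exact_mod_cast hh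
  have hpos : 0 < ‖linForm α β p‖ ^ r := (mul_pos hh0 (by linarith)).trans_le hpW
  have hξ : linForm α β p ≠ 0 := by
    intro h0
    rw [h0, norm_zero, zero_pow hr] at hpos
    exact hpos.false
  have hz : (h : ℝ) / ‖linForm α β p‖ ^ r ≤ 1 / 2 := by
    rw [div_le_iff₀ hpos]
    nlinarith
  exact ⟨hξ, ne_zero_of_norm_sub_le hr hξ (hF.norm_sub_le hp).1 hz,
    (norm_div_pow_sub_one_le hξ (hF.norm_sub_le hp).1).trans hz⟩

theorem IsDefiniteForm.aeval_ne_zero {F : MvPolynomial (Fin 2) ℤ} (hF : IsDefiniteForm F)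
    {v : Fin 2 → ℝ} (hv : v ≠ 0) : aeval v F ≠ 0 := by
  rcases hF with h | h
  · exact (h v hv).ne'
  · exact (h v hv).ne

theorem numPrimitiveSolutions_bounds {r : ℕ} (hr : 5 ≤ r) {F : MvPolynomial (Fin 2) ℤ} {D : ℤ}
    (hD : IsQuadraticDiscriminant r F D) {h : ℤ} (hpos : 0 < h) {ε : ℝ} (hε : 0 < ε)
    (hε' : ε < 1 / (2 * ((r : ℝ) - 1)))
    (hh : (h : ℝ) ≤ |(formDiscr r F : ℝ)| ^ (1 / (2 * ((r : ℝ) - 1)) - ε) /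
      ((2 : ℝ) ^ ((r : ℝ) / 2) * (r : ℝ) ^ 7)) {m : ℕ} (hm : 3 ≤ m)
    (hmε : ((r : ℝ) ^ 2 + r + 2) /
      (4 * ((r : ℝ) - 1) * (((r : ℝ) - 1) ^ (m - 1) - 2 * r - 1)) < ε) :
    numPrimitiveSolutions F h ≤ ((r * m : ℕ) : ℕ∞) ∧
      (0 < D → Even r → numPrimitiveSolutions F h ≤ ((2 * m : ℕ) : ℕ∞)) ∧
      (0 < D → Odd r → numPrimitiveSolutions F h ≤ (m : ℕ∞)) ∧
      (0 < D → IsDefiniteForm F → numPrimitiveSolutions F h ≤ 1) := by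
  classical
  obtain ⟨α, β, γ, δ, χ, a, b, c, g, H, hDg⟩ := hD.exists_primitive
  have hDpos : 0 < D → 0 < b ^ 2 - 4 * a * c := fun h0 => by
    rw [hDg] at h0
    exact (pos_iff_pos_of_mul_pos h0).1 (by
      rcases eq_or_ne g 0 with rfl | hg
      · simp at h0
      · positivity)
  have hj : 0 < ‖α * δ - β * γ‖ := norm_pos_iff.2 H.diag.1
  have hd := H.diag.norm_formDiscr (by omega)
  set d := |(formDiscr r F : ℝ)|
  have hh0 : (1 : ℝ) ≤ h := by exact_mod_cast hpos
  have hT := log_disc_pos hr hj hd hh0 hε' hh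
  have hd0 : 0 < d := by rw [hd]; positivity
  have hd1 : 1 ≤ d := ((Real.log_pos_iff hd0.le).1 hT).le
  have hW := sizeRatio_ge (r := r) hr hε hd1
  have hjh := two_pow_mul_height_lt (ε := ε) hr hj hd hh0 hh
  have hK := log_height_bound hr hj hd hh0 hε hε' hh hm hmε (norm_pos_iff.2 H.s_ne_zero)
    (H.norm_s_pow_le (by omega))
  set W := sizeRatio r d ε
  have hcount : ∀ (Ω : Finset ℂ) (N : ℕ), 1 + Ω.card * (m - 1) ≤ N →
      (∀ p ∈ normalizedSolutions F h, h * W ≤ ‖linForm α β p‖ ^ r →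
        rootClass r (linForm α β p) (linForm γ δ p) ∈ Ω) →
      numPrimitiveSolutions F h ≤ (N : ℕ∞) := fun Ω N hN hΩ =>
    (numPrimitiveSolutions_le H.diag h).trans
      ((encard_normalizedSolutions_le hr H hpos hW hjh hm hK Ω hΩ).trans (by exact_mod_cast hN))
  have hlarge := fun {p : ℤ × ℤ} => H.diag.large_solution (by omega : r ≠ 0) hpos hW (p := p)
  -- For `k ≥ 1` the single small solution fits into the slack: `1 + k (m - 1) ≤ k m`.
  have hroots : ∀ k N : ℕ, k ≠ 0 → (k * m ≤ N) → ∀ Ω : Finset ℂ, Ω.card ≤ k →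
      (∀ p ∈ normalizedSolutions F h, h * W ≤ ‖linForm α β p‖ ^ r →
        rootClass r (linForm α β p) (linForm γ δ p) ∈ Ω) →
      numPrimitiveSolutions F h ≤ (N : ℕ∞) := by
    intro k N hk hN Ω hΩ hmem
    refine hcount Ω N ?_ hmem
    obtain ⟨n, rfl⟩ := Nat.exists_eq_add_of_le' (by omega : 1 ≤ m)
    have h1 : Ω.card * n ≤ k * n := Nat.mul_le_mul_right n hΩ
    rw [Nat.mul_add, Nat.mul_one] at hN
    rw [Nat.add_sub_cancel]
    omega
  refine ⟨?_, fun h0 hev => ?_, fun h0 hodd => ?_, fun h0 hdef => ?_⟩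
  · refine hroots r (r * m) (by omega) le_rfl (Polynomial.nthRoots r (1 : ℂ)).toFinset
      ((Multiset.toFinset_card_le _).trans (Polynomial.card_nthRoots r 1)) fun p hp hpW => ?_
    obtain ⟨hξ, hη, -⟩ := hlarge hp hpW
    rw [Multiset.mem_toFinset, Polynomial.mem_nthRoots (by omega)]
    exact rootClass_pow (by omega) hξ hη
  · by_cases hex : ∃ p ∈ normalizedSolutions F h, h * W ≤ ‖linForm α β p‖ ^ r
    · obtain ⟨p, hp, hpW⟩ := hex
      obtain ⟨hξ, hη, hx⟩ := hlarge hp hpW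
      refine hroots 2 (2 * m) (by omega) le_rfl {rootClass r (linForm α β p) (linForm γ δ p),
        -rootClass r (linForm α β p) (linForm γ δ p)} Finset.card_le_two fun q hq hqW => ?_
      obtain ⟨hξ', hη', hx'⟩ := hlarge hq hqW
      rcases H.rootClass_eq_or_eq_neg (by omega) (hDpos h0) hξ hη hξ' hη' hx hx' with e | e
      · simp [e]
      · simp [e.2]
    · exact hroots 2 (2 * m) (by omega) le_rfl ∅ (by simp) fun p hp hpW => (hex ⟨p, hp, hpW⟩).elim
  · by_cases hex : ∃ p ∈ normalizedSolutions F h, h * W ≤ ‖linForm α β p‖ ^ r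
    · obtain ⟨p, hp, hpW⟩ := hex
      obtain ⟨hξ, hη, hx⟩ := hlarge hp hpW
      refine hroots 1 m (by omega) (by omega) {rootClass r (linForm α β p) (linForm γ δ p)}
        (by simp) fun q hq hqW => ?_
      obtain ⟨hξ', hη', hx'⟩ := hlarge hq hqW
      rcases H.rootClass_eq_or_eq_neg (by omega) (hDpos h0) hξ hη hξ' hη' hx hx' with e | e
      · simp [e]
      · exact absurd e.1 (Nat.not_even_iff_odd.2 hodd)
    · exact hroots 1 m (by omega) (by omega) ∅ (by simp) fun p hp hpW => (hex ⟨p, hp, hpW⟩).elim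
  -- A definite form has no large solution, so only the possible small one remains.
  · refine hcount ∅ 1 (by simp) fun p hp hpW => ?_
    obtain ⟨hξ, hη, hx⟩ := hlarge hp hpW
    obtain ⟨v, hv, hFv⟩ := H.exists_real_zero (by omega) (hDpos h0) hξ hη hx
    exact absurd hFv (hdef.aeval_ne_zero hv)

/-- The choice of `m` for a given `ε`. -/
theorem exists_exponent_of_ceil {R ε : ℝ} (hR : 5 ≤ R) (hε : 0 < ε) (hε' : ε < 1 / (2 * (R - 1))) :
    ∃ m : ℕ, 3 ≤ m ∧ (m : ℤ) = 4 + ⌈(Real.log (1 / ε) - Real.log 4) / Real.log (R - 1)⌉ ∧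
      (R ^ 2 + R + 2) / (4 * (R - 1) * ((R - 1) ^ (m - 1) - 2 * R - 1)) < ε := by
  set t := (Real.log (1 / ε) - Real.log 4) / Real.log (R - 1) with ht
  have hlR : 0 < Real.log (R - 1) := Real.log_pos (by linarith)
  have hεR : 2 * (R - 1) * ε < 1 := by
    rw [lt_div_iff₀ (by linarith)] at hε'
    linarith
  have hlog : Real.log (1 / ε) - Real.log 4 = Real.log (1 / (4 * ε)) := by
    rw [← Real.log_div (by positivity) (by norm_num)]
    congr 1
    field_simp
  have ht0 : 0 ≤ t := by
    refine div_nonneg ?_ hlR.le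
    rw [hlog]
    refine Real.log_nonneg ?_
    rw [le_div_iff₀ (by positivity)]
    nlinarith
  obtain ⟨k, hk⟩ := Int.eq_ofNat_of_zero_le (Int.ceil_nonneg ht0)
  -- The ceiling `k` is nonnegative because `ε < 1 / 8`. It is chosen so that `(R - 1) ^ k ≥ 1 / (4
  -- ε)`, and the three further powers of `R - 1` absorb the lower-order terms.
  refine ⟨4 + k, by omega, by rw [hk]; push_cast; rfl, ?_⟩
  have hpow : 1 / (4 * ε) ≤ (R - 1) ^ k := by
    rw [← Real.log_le_log_iff (by positivity) (pow_pos (by linarith) k), Real.log_pow, ← hlog,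
      ← div_le_iff₀ hlR, ← ht]
    have := Int.le_ceil t
    rw [hk] at this
    exact_mod_cast this
  rw [div_le_iff₀ (by positivity)] at hpow
  rw [show 4 + k - 1 = k + 3 by omega, pow_add]
  set Q := (R - 1) ^ k
  have hR1 : 4 ≤ R - 1 := by linarith
  have hQ : (R - 1) ^ 3 * 1 ≤ (R - 1) ^ 3 * (Q * (4 * ε)) :=
    mul_le_mul_of_nonneg_left hpow (by positivity)
  have h1 : (2 * (2 * R + 1)) * (2 * (R - 1) * ε) ≤ (2 * (2 * R + 1)) * 1 :=
    mul_le_mul_of_nonneg_left hεR.le (by linarith)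
  have h2 : R ^ 2 + R + 2 < (R - 1) * (R - 1) ^ 3 - 2 * (2 * R + 1) := by
    have : 16 * ((R - 1) * (R - 1)) ≤ (R - 1) * (R - 1) * ((R - 1) * (R - 1)) := by
      have h3 : 16 ≤ (R - 1) * (R - 1) := by nlinarith
      nlinarith
    nlinarith
  have h3 : (R - 1) * ((R - 1) ^ 3 * 1) ≤ (R - 1) * ((R - 1) ^ 3 * (Q * (4 * ε))) :=
    mul_le_mul_of_nonneg_left hQ (by linarith)
  have h4 : R ^ 2 + R + 2 < ε * (4 * (R - 1) * (Q * (R - 1) ^ 3 - 2 * R - 1)) := by linarith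
  have h5 : 0 < 4 * (R - 1) * (Q * (R - 1) ^ 3 - 2 * R - 1) :=
    (pos_iff_pos_of_mul_pos (lt_trans (by positivity) h4)).1 hε
  rwa [div_lt_iff₀ h5]

theorem corollary1p6 (r : ℕ) (hr : 5 ≤ r) (F : MvPolynomial (Fin 2) ℤ)
    (hF : IsDiagonalizable r F) (D : ℤ) (hD : IsQuadraticDiscriminant r F D)
    (h : ℤ) (hpos : 0 < h) (ε : ℝ) (hε : 0 < ε) (hε' : ε < 1 / (2 * ((r : ℝ) - 1)))
    (hh : (h : ℝ) ≤ |(formDiscr r F : ℝ)| ^ (1 / (2 * ((r : ℝ) - 1)) - ε) /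
      ((2 : ℝ) ^ ((r : ℝ) / 2) * (r : ℝ) ^ 7)) :
    (∀ m : ℕ, 3 ≤ m →
      ((r : ℝ) ^ 2 + r + 2) / (4 * ((r : ℝ) - 1) * (((r : ℝ) - 1) ^ (m - 1) - 2 * r - 1)) < ε →
      (D < 0 → numPrimitiveSolutions F h ≤ ((r * m : ℕ) : ℕ∞)) ∧
      (0 < D → Even r → IsIndefiniteForm F →
        numPrimitiveSolutions F h ≤ ((2 * m : ℕ) : ℕ∞)) ∧
      (0 < D → Odd r → IsIndefiniteForm F → numPrimitiveSolutions F h ≤ (m : ℕ∞)) ∧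
      (0 < D → IsDefiniteForm F → numPrimitiveSolutions F h ≤ 1)) ∧
    (D < 0 → ∃ N : ℕ, numPrimitiveSolutions F h = N ∧
      (N : ℤ) ≤ (4 + ⌈(Real.log (1 / ε) - Real.log 4) / Real.log ((r : ℝ) - 1)⌉) * r) := by
  refine ⟨fun m hm hmε => ?_, fun _ => ?_⟩
  · obtain ⟨h1, h2, h3, h4⟩ := numPrimitiveSolutions_bounds hr hD hpos hε hε' hh hm hmε
    exact ⟨fun _ => h1, fun h0 hev _ => h2 h0 hev, fun h0 hodd _ => h3 h0 hodd, h4⟩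
  · obtain ⟨m, hm, hmc, hmε⟩ := exists_exponent_of_ceil (R := r) (by exact_mod_cast hr) hε hε'
    obtain ⟨h1, -⟩ := numPrimitiveSolutions_bounds hr hD hpos hε hε' hh hm hmε
    obtain ⟨N, hN⟩ := ENat.ne_top_iff_exists.1
      (ne_top_of_le_ne_top (ENat.natCast_ne_top _) h1)
    refine ⟨N, hN.symm, ?_⟩
    rw [← hN, Nat.cast_le] at h1
    rw [← hmc, mul_comm]
    exact_mod_cast h1
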